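/- Consider the intuitionistic predicate language with countably many individual variables, countably many predicate letters of every arity, $\bot,\wedge,\vee,\to,\forall,\exists$, and no function symbols or equality. An intuitionistic predicate Kripke model consists of a non-empty partially ordered set of worlds, a non-empty domain $D_w$ for every world $w$ with $D_u\subseteq D_w$ whenever $u\le w$, and interpretations of the predicate letters at the worlds by relations on $D_w$ that can only grow along $\le$; truth at a world is defined by the usual intuitionistic clauses. Let $\mathbf{QInt}$ be the set of formulas that are true in every such model, at every world $w$, under every assignment sending the free variables of the formula to $D_w$. Let $\mathbf{QLC}$ be the smallest set of formulas that contains $\mathbf{QInt}$ and all formulas $(\varphi\to\psi)\vee(\psi\to\varphi)$ and is closed under modus ponens and generalization, and let $\mathbf{QLC.cd}$ be the smallest set with the same properties that also contains all formulas $\forall x\,(\varphi\vee\psi)\to\forall x\,\varphi\vee\psi$ in which $x$ is not free in $\psi$. The positive fragment $L^+$ of a set $L$ of formulas is the set of the formulas in $L$ in which $\bot$ does not occur. A set of formulas is $\Sigma^0_1$-complete if, with respect to a standard Gödel numbering, it is recursively enumerable and every recursively enumerable set of natural numbers is many-one reducible to it. Theorem. For $L=\mathbf{QLC}$ and for $L=\mathbf{QLC.cd}$,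 the positive fragment $L^+$ is $\Sigma^0_1$-complete. Moreover, for both $L$, the set of those formulas in $L^+$ that contain (free or bound) no individual variables other than two fixed ones, and no predicate letters other than one fixed binary letter and the (infinitely many) unary letters, is $\Sigma^0_1$-complete. -/

import Mathlib

namespace IntPred

/-- Formulas of the intuitionistic predicate language: countably many individual variables
`0, 1, 2, …`, countably many predicate letters of every arity, no function symbols and no equality.
`atom k args` is the atomic formula `P(args)` where `P` is the `k`-th predicate letter
of arity `args.length`; letters of different arities are different letters. -/
inductive Formula : Type
  | bot : Formula
  | atom (k : ℕ) (args : List ℕ) : Formula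
  | and (φ ψ : Formula) : Formula
  | or (φ ψ : Formula) : Formula
  | imp (φ ψ : Formula) : Formula
  | all (x : ℕ) (φ : Formula) : Formula
  | ex (x : ℕ) (φ : Formula) : Formula

namespace Formula

/-- The free individual variables of a formula. -/
def freeVars : Formula → Set ℕ
  | bot => ∅
  | atom _ args => {x | x ∈ args}
  | and φ ψ => φ.freeVars ∪ ψ.freeVars
  | or φ ψ => φ.freeVars ∪ ψ.freeVars
  | imp φ ψ => φ.freeVars ∪ ψ.freeVars
  | all x φ => φ.freeVars \ {x}
  | ex x φ => φ.freeVars \ {x}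

/-- A formula is positive if `⊥` does not occur in it. -/
def Positive : Formula → Prop
  | bot => False
  | atom _ _ => True
  | and φ ψ => φ.Positive ∧ ψ.Positive
  | or φ ψ => φ.Positive ∧ ψ.Positive
  | imp φ ψ => φ.Positive ∧ ψ.Positive
  | all _ φ => φ.Positive
  | ex _ φ => φ.Positive

/-- Formulas of the restricted language: every individual variable that occurs, free or bound, is
`0` or `1`; every predicate letter that occurs is a unary letter (any of them) or
one fixed binary letter, the one with index `0`. -/
def Restricted : Formula → Prop
  | bot => True
  | atom k args => (∀ x ∈ args, x < 2) ∧ (args.length = 1 ∨ (args.length = 2 ∧ k = 0))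
  | and φ ψ => φ.Restricted ∧ ψ.Restricted
  | or φ ψ => φ.Restricted ∧ ψ.Restricted
  | imp φ ψ => φ.Restricted ∧ ψ.Restricted
  | all x φ => x < 2 ∧ φ.Restricted
  | ex x φ => x < 2 ∧ φ.Restricted

/-- A standard (bijective) Gödel numbering of formulas. -/
def code : Formula → ℕ
  | bot => 0
  | atom k args => 6 * Nat.pair k (Encodable.encode args) + 1
  | and φ ψ => 6 * Nat.pair φ.code ψ.code + 2
  | or φ ψ => 6 * Nat.pair φ.code ψ.code + 3
  | imp φ ψ => 6 * Nat.pair φ.code ψ.code + 4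
  | all x φ => 6 * Nat.pair x φ.code + 5
  | ex x φ => 6 * Nat.pair x φ.code + 6

theorem code_pair_inj {a b c d i : ℕ} (h : 6 * Nat.pair a b + i = 6 * Nat.pair c d + i) :
    a = c ∧ b = d :=
  Nat.pair_eq_pair.1 (by omega)

theorem code_injective : Function.Injective code := by
  intro φ
  induction φ with
  | bot => intro ψ h; cases ψ <;> simp only [code] at h <;> first | rfl | omega
  | atom k l =>
    intro ψ h
    cases ψ <;> simp only [code] at h <;> try omega
    have h' := code_pair_inj h
    rw [h'.1, Encodable.encode_injective h'.2]
  | and a b iha ihb =>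
    intro ψ h
    cases ψ <;> simp only [code] at h <;> try omega
    have h' := code_pair_inj h
    rw [iha h'.1, ihb h'.2]
  | or a b iha ihb =>
    intro ψ h
    cases ψ <;> simp only [code] at h <;> try omega
    have h' := code_pair_inj h
    rw [iha h'.1, ihb h'.2]
  | imp a b iha ihb =>
    intro ψ h
    cases ψ <;> simp only [code] at h <;> try omega
    have h' := code_pair_inj h
    rw [iha h'.1, ihb h'.2]
  | all x a iha =>
    intro ψ h
    cases ψ <;> simp only [code] at h <;> try omega
    have h' := code_pair_inj h
    rw [h'.1, iha h'.2]
  | ex x a iha =>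
    intro ψ h
    cases ψ <;> simp only [code] at h <;> try omega
    have h' := code_pair_inj h
    rw [h'.1, iha h'.2]

theorem code_surjective : Function.Surjective code := by
  intro n
  induction n using Nat.strong_induction_on with
  | _ n ih =>
    rcases Nat.eq_zero_or_pos n with rfl | hn
    · exact ⟨bot, rfl⟩
    · have hp : Nat.pair (Nat.unpair ((n - 1) / 6)).1 (Nat.unpair ((n - 1) / 6)).2 = (n - 1) / 6 :=
        Nat.pair_unpair _
      have h1 := Nat.unpair_left_le ((n - 1) / 6)
      have h2 := Nat.unpair_right_le ((n - 1) / 6)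
      obtain ⟨φ, hφ⟩ := ih (Nat.unpair ((n - 1) / 6)).1 (by omega)
      obtain ⟨ψ, hψ⟩ := ih (Nat.unpair ((n - 1) / 6)).2 (by omega)
      have h6 : (n - 1) % 6 < 6 := Nat.mod_lt _ (by omega)
      have hc : (n - 1) % 6 = 0 ∨ (n - 1) % 6 = 1 ∨ (n - 1) % 6 = 2 ∨ (n - 1) % 6 = 3 ∨
          (n - 1) % 6 = 4 ∨ (n - 1) % 6 = 5 := by omega
      rcases hc with h | h | h | h | h | h
      · refine ⟨atom (Nat.unpair ((n - 1) / 6)).1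
          (Denumerable.ofNat (List ℕ) (Nat.unpair ((n - 1) / 6)).2), ?_⟩
        simp only [code, Denumerable.encode_ofNat, hp]; omega
      · exact ⟨and φ ψ, by simp only [code, hφ, hψ, hp]; omega⟩
      · exact ⟨or φ ψ, by simp only [code, hφ, hψ, hp]; omega⟩
      · exact ⟨imp φ ψ, by simp only [code, hφ, hψ, hp]; omega⟩
      · exact ⟨all (Nat.unpair ((n - 1) / 6)).1 ψ, by simp only [code, hψ, hp]; omega⟩
      · exact ⟨ex (Nat.unpair ((n - 1) / 6)).1 ψ, by simp only [code, hψ, hp]; omega⟩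

/-- Computability on formulas is understood through the Gödel numbering `code`. -/
noncomputable instance : Denumerable Formula :=
  Denumerable.mk' (Equiv.ofBijective code ⟨code_injective, code_surjective⟩)

theorem encode_eq_code (φ : Formula) : Encodable.encode φ = φ.code := rfl

end Formula

/-- Intuitionistic predicate Kripke models, with expanding domains. `R` is the accessibility
relation, `dom w` the local domain of the world `w`, and the restriction of `interp w k` to
lists of length `n` is the relation on `dom w` which interprets, at `w`,
the `k`-th `n`-ary predicate letter. -/
structure KripkeModel : Type 1 where
  World : Type
  world_nonempty : Nonempty World
  R : World → World → Prop
  refl : ∀ w, R w w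
  trans : ∀ u v w, R u v → R v w → R u w
  antisymm : ∀ u v, R u v → R v u → u = v
  Ind : Type
  dom : World → Set Ind
  dom_nonempty : ∀ w, (dom w).Nonempty
  dom_expanding : ∀ u w, R u w → dom u ⊆ dom w
  interp : World → ℕ → Set (List Ind)
  interp_dom : ∀ w k, ∀ l ∈ interp w k, ∀ d ∈ l, d ∈ dom w
  interp_hereditary : ∀ u w, R u w → ∀ k, interp u k ⊆ interp w k

namespace KripkeModel

/-- `M.Forces w g φ`: the formula `φ` is true at the world `w` of `M` under the assignment `g`. -/
def Forces (M : KripkeModel) : M.World → (ℕ → M.Ind) → Formula → Prop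
  | _, _, .bot => False
  | w, g, .atom k args => args.map g ∈ M.interp w k
  | w, g, .and φ ψ => M.Forces w g φ ∧ M.Forces w g ψ
  | w, g, .or φ ψ => M.Forces w g φ ∨ M.Forces w g ψ
  | w, g, .imp φ ψ => ∀ v, M.R w v → M.Forces v g φ → M.Forces v g ψ
  | w, g, .all x φ => ∀ v, M.R w v → ∀ d ∈ M.dom v, M.Forces v (Function.update g x d) φ
  | w, g, .ex x φ => ∃ d ∈ M.dom w, M.Forces w (Function.update g x d) φ

/-- `φ` is true in `M`: it is true at every world `w` under every assignment which sends
the free variables of `φ` to elements of the domain of `w`. -/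
def Valid (M : KripkeModel) (φ : Formula) : Prop :=
  ∀ (w : M.World) (g : ℕ → M.Ind), (∀ x ∈ φ.freeVars, g x ∈ M.dom w) → M.Forces w g φ

end KripkeModel

/-- The intuitionistic predicate logic **QInt**: the formulas true in all intuitionistic
predicate Kripke models. -/
def QInt : Set Formula := {φ | ∀ M : KripkeModel, M.Valid φ}

/-- The superintuitionistic predicate logic axiomatized over **QInt** by a set `Ax` of axioms:
the closure of `QInt ∪ Ax` under modus ponens and generalization. It is applied below to axiom
schemes, i.e. to all substitution instances of an axiom. -/
inductive Ext (Ax : Set Formula) : Formula → Prop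
  | int (φ : Formula) (h : φ ∈ QInt) : Ext Ax φ
  | ax (φ : Formula) (h : φ ∈ Ax) : Ext Ax φ
  | mp (φ ψ : Formula) (h₁ : Ext Ax (φ.imp ψ)) (h₂ : Ext Ax φ) : Ext Ax ψ
  | gen (x : ℕ) (φ : Formula) (h : Ext Ax φ) : Ext Ax (φ.all x)

/-- The linearity axioms: the formulas `(φ → ψ) ∨ (ψ → φ)`. -/
def LinAxioms : Set Formula :=
  {χ | ∃ φ ψ : Formula, χ = (φ.imp ψ).or (ψ.imp φ)}

/-- The constant domain axioms: the formulas `∀ x (φ ∨ ψ) → ∀ x φ ∨ ψ` in which `x` is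
not free in `ψ`, i.e. the instances of **cd** `= ∀ x (P(x) ∨ p) → ∀ x P(x) ∨ p`. -/
def CdAxioms : Set Formula :=
  {χ | ∃ (x : ℕ) (φ ψ : Formula), x ∉ ψ.freeVars ∧
    χ = ((φ.or ψ).all x).imp ((φ.all x).or ψ)}

/-- **QLC** `=` **QInt** `+ (p → q) ∨ (q → p)`. -/
def QLC : Set Formula := {φ | Ext LinAxioms φ}

/-- **QLC.cd** `=` **QLC** `+` **cd**. -/
def QLCcd : Set Formula := {φ | Ext (LinAxioms ∪ CdAxioms) φ}

/-- A set of formulas is `Σ⁰₁`-complete if it is recursively enumerable and every recursively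
enumerable set of natural numbers is many-one reducible to it. -/
def Sigma1Complete (L : Set Formula) : Prop :=
  REPred (fun φ : Formula => φ ∈ L) ∧
    ∀ q : ℕ → Prop, REPred q → ManyOneReducible q (fun φ : Formula => φ ∈ L)

/-- The positive fragment `L⁺` of `L`. -/
def positiveFragment (L : Set Formula) : Set Formula := {φ | φ ∈ L ∧ φ.Positive}

/-- The part of `L` in the language with two individual variables, a single binary
predicate letter and infinitely many unary predicate letters. -/
def restrictedFragment (L : Set Formula) : Set Formula := {φ | φ ∈ L ∧ φ.Restricted}

end IntPred

/-!
The two halves of `Σ⁰₁`-completeness are independent of each other.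

*Hardness.* It suffices to reduce the halting problem by formulas `haltFormula c n` that are
positive, restricted, and belong to `QInt` if the code `c` halts at `[n]` but not even to `QLC.cd`
if it does not (`manyOneReducible_of_between`). The computations of `c` are described by a theory
of Horn rules with two individual variables about lists of numbers (`listRules`, `codeRules`).
Instead of functions, the rules speak of attributes of individuals and of equality of attributes.
An attribute is a unary letter `P`, and its value at an individual `d` is the truth value of
`P(d)`, that is, the set of the worlds above the given one at which `P(d)` is true; so equality of
attributes is expressed by `(P(x) → Q(y)) ∧ (Q(y) → P(x))`. In an arbitrary Kripke model these
truth values are as good as any other values, and the rules derive the halting of `c`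
(`IsRep.eval`, `haltFormula_mem_QInt`). Conversely, natural numbers can be realized as different
truth values over a linearly ordered set of worlds with constant domain: `n` becomes the set of
the worlds greater than `n`. So if `c` does not halt, the intended structure of all lists becomes
a countermodel for `QLC.cd` (`Str.linearModel`, `haltFormula_notMem_QLCcd`). Falsity is replaced
by a positive formula that fails only at the root of this model.

*Recursive enumerability.* A formula is in the logic axiomatized by a set of axioms iff it is
implied in `QInt` by finitely many universally quantified axioms (`ext_iff_exists_chain`), so that
only `QInt` has to be enumerated. By Skolemization, every countermodel gives one whose worlds and
individuals are natural numbers and in which the witnesses for implications and quantifiers sit at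
prescribed places. Such models are valuations of a countable set of atomic statements subject to a
decidable list of conditions on finitely many statements each (`Coherent`, `coherent_iff`,
`mem_QInt_iff_coherent`). By compactness a formula is valid iff finitely many of these conditions
rule out that it fails, which is witnessed by a number `N` with a decidable property
(`mem_QInt_iff_exists_certificate`, `primrecRel_certificate`).
-/

namespace IntPred

/-! ### Forcing: persistence, dependence on free variables, universal closures -/

namespace KripkeModel

variable {M : KripkeModel}

theorem Forces.mono {φ : Formula} {u v : M.World} {g : ℕ → M.Ind} (h : M.Forces u g φ)
    (huv : M.R u v) : M.Forces v g φ := by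
  induction φ generalizing u v g with
  | bot => exact h
  | atom k args => exact M.interp_hereditary u v huv k h
  | and φ ψ ihφ ihψ => exact ⟨ihφ h.1 huv, ihψ h.2 huv⟩
  | or φ ψ ihφ ihψ => exact h.imp (ihφ · huv) (ihψ · huv)
  | imp φ ψ => exact fun w hw => h w (M.trans _ _ _ huv hw)
  | all x φ => exact fun w hw => h w (M.trans _ _ _ huv hw)
  | ex x φ ih =>
    obtain ⟨d, hd, h⟩ := h
    exact ⟨d, M.dom_expanding u v huv hd, ih h huv⟩

theorem forces_congr {φ : Formula} {w : M.World} {g g' : ℕ → M.Ind}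
    (h : ∀ x ∈ φ.freeVars, g x = g' x) : M.Forces w g φ ↔ M.Forces w g' φ := by
  have upd : ∀ {x : ℕ} {ψ : Formula} {f f' : ℕ → M.Ind},
      (∀ y ∈ ψ.freeVars \ {x}, f y = f' y) → ∀ d, ∀ y ∈ ψ.freeVars,
        Function.update f x d y = Function.update f' x d y := by
    intro x ψ f f' hf d y hy
    by_cases hyx : y = x
    · simp [hyx]
    · simpa [hyx] using hf y ⟨hy, hyx⟩
  induction φ generalizing w g g' with
  | bot => exact Iff.rfl
  | atom k args =>
    have : args.map g = args.map g' := List.map_congr_left h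
    simp [Forces, this]
  | and φ ψ ihφ ihψ =>
    exact and_congr (ihφ fun x hx => h x (Or.inl hx)) (ihψ fun x hx => h x (Or.inr hx))
  | or φ ψ ihφ ihψ =>
    exact or_congr (ihφ fun x hx => h x (Or.inl hx)) (ihψ fun x hx => h x (Or.inr hx))
  | imp φ ψ ihφ ihψ =>
    exact forall₂_congr fun v _ =>
      imp_congr (ihφ fun x hx => h x (Or.inl hx)) (ihψ fun x hx => h x (Or.inr hx))
  | all x φ ih => exact forall₄_congr fun v _ d _ => ih (upd h d)
  | ex x φ ih => exact exists_congr fun d => and_congr_right fun _ => ih (upd h d)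

end KripkeModel

/-- Membership in `QInt` can be tested on assignments that send *all* variables to the local
domain. -/
theorem mem_QInt_iff {φ : Formula} :
    φ ∈ QInt ↔ ∀ (M : KripkeModel) (w : M.World) (g : ℕ → M.Ind),
      (∀ x, g x ∈ M.dom w) → M.Forces w g φ := by
  classical
  refine ⟨fun h M w g hg => h M w g fun x _ => hg x, fun h M w g hg => ?_⟩
  obtain ⟨d, hd⟩ := M.dom_nonempty w
  have := h M w (fun x => if x ∈ φ.freeVars then g x else d) fun x => by
    by_cases hx : x ∈ φ.freeVars <;> simp [hx, hd, hg]
  refine (KripkeModel.forces_congr fun x hx => ?_).1 this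
  simp [hx]

namespace Formula

/-- The formula `φ` prefixed with universal quantifiers over the variables below `n`. -/
def allBelow : ℕ → Formula → Formula
  | 0, φ => φ
  | n + 1, φ => (allBelow n φ).all n

/-- The formula `∀ A₁ → ⋯ → ∀ Aₘ → φ`, each `∀` standing for quantifiers over the variables
below `n`. -/
def chain (n : ℕ) (L : List Formula) (φ : Formula) : Formula :=
  L.foldr (fun A ψ => (allBelow n A).imp ψ) φ

end Formula

open Formula

theorem KripkeModel.forces_allBelow {M : KripkeModel} {n : ℕ} {φ : Formula} {w : M.World}
    {g : ℕ → M.Ind} :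
    M.Forces w g (allBelow n φ) ↔ ∀ v, M.R w v → ∀ g' : ℕ → M.Ind,
      (∀ x < n, g' x ∈ M.dom v) → (∀ x, n ≤ x → g' x = g x) → M.Forces v g' φ := by
  induction n generalizing w g with
  | zero =>
    refine ⟨fun h v hv g' _ hg' => ?_, fun h => h w (M.refl w) g (by simp) fun _ _ => rfl⟩
    rw [show g' = g from funext fun x => hg' x x.zero_le]
    exact Forces.mono h hv
  | succ n ih =>
    constructor
    · intro h v hv g' hd hg'
      refine ih.1 (h v hv (g' n) (hd n n.lt_succ_self)) v (M.refl v) g'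
        (fun x hx => hd x (by omega)) fun x hx => ?_
      by_cases hxn : x = n
      · simp [hxn]
      · simpa [hxn] using hg' x (by omega)
    · intro h v hv d hd
      refine ih.2 fun u hu g' hd' hg' => h u (M.trans _ _ _ hv hu) g' (fun x hx => ?_) fun x hx => ?_
      · by_cases hxn : x = n
        · rw [hg' x hxn.ge, hxn]
          simpa using M.dom_expanding _ _ hu hd
        · exact hd' x (by omega)
      · rw [hg' x (by omega), Function.update_of_ne (by omega)]

/-! ### Derivations from axioms reduce to validity of implications -/

variable {Ax Ax' : Set Formula}

theorem Ext.of_axioms (h : ∀ φ ∈ Ax, Ext Ax' φ) {φ : Formula} (hφ : Ext Ax φ) : Ext Ax' φ := by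
  induction hφ with
  | int φ hφ => exact .int φ hφ
  | ax φ hφ => exact h φ hφ
  | mp φ ψ _ _ ih₁ ih₂ => exact .mp φ ψ ih₁ ih₂
  | gen x φ _ ih => exact .gen x φ ih

theorem Ext.allBelow {φ : Formula} (h : Ext Ax φ) (n : ℕ) : Ext Ax (allBelow n φ) := by
  induction n with
  | zero => exact h
  | succ n ih => exact .gen n _ ih

theorem Ext.of_chain {n : ℕ} {L : List Formula} {φ : Formula} (hL : ∀ A ∈ L, A ∈ Ax)
    (h : Ext Ax (chain n L φ)) : Ext Ax φ := by
  induction L with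
  | nil => exact h
  | cons A L ih =>
    refine ih (fun B hB => hL B (List.mem_cons_of_mem _ hB)) (.mp _ _ h ?_)
    exact (Ext.ax A (hL A List.mem_cons_self)).allBelow n

theorem KripkeModel.forces_chain {M : KripkeModel} {n : ℕ} {L : List Formula} {φ : Formula}
    {g : ℕ → M.Ind} {w : M.World}
    (h : ∀ v, M.R w v → (∀ A ∈ L, M.Forces v g (Formula.allBelow n A)) → M.Forces v g φ) :
    M.Forces w g (chain n L φ) := by
  induction L generalizing w with
  | nil => exact h w (M.refl w) (by simp)
  | cons A L ih =>
    intro v hv hA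
    refine ih fun u hu hL => h u (M.trans _ _ _ hv hu) fun B hB => ?_
    rcases List.mem_cons.1 hB with rfl | hB
    · exact Forces.mono hA hu
    · exact hL B hB

/-- A derivation uses finitely many axioms and generalizes over finitely many variables; its
conclusion follows locally, at each world, from the axioms it uses, each prefixed with quantifiers
over a long enough initial segment of the variables. -/
theorem Ext.exists_forces {φ : Formula} (h : Ext Ax φ) :
    ∃ (n₀ : ℕ) (L : List Formula), (∀ A ∈ L, A ∈ Ax) ∧ ∀ n, n₀ ≤ n →
      ∀ (M : KripkeModel) (w : M.World) (g : ℕ → M.Ind), (∀ x, g x ∈ M.dom w) →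
        (∀ A ∈ L, M.Forces w g (Formula.allBelow n A)) → M.Forces w g φ := by
  induction h with
  | int φ hφ => exact ⟨0, [], by simp, fun n _ M w g hg _ => mem_QInt_iff.1 hφ M w g hg⟩
  | ax φ hφ =>
    refine ⟨0, [φ], by simpa using hφ, fun n _ M w g hg hA => ?_⟩
    exact KripkeModel.forces_allBelow.1 (hA φ (by simp)) w (M.refl w) g (fun x _ => hg x)
      fun _ _ => rfl
  | mp φ ψ _ _ ih₁ ih₂ =>
    obtain ⟨n₁, L₁, hL₁, h₁⟩ := ih₁
    obtain ⟨n₂, L₂, hL₂, h₂⟩ := ih₂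
    refine ⟨max n₁ n₂, L₁ ++ L₂, fun A hA => ?_, fun n hn M w g hg hA => ?_⟩
    · exact (List.mem_append.1 hA).elim (hL₁ A) (hL₂ A)
    · refine h₁ n (le_of_max_le_left hn) M w g hg (fun A h => hA A (by simp [h])) w (M.refl w) ?_
      exact h₂ n (le_of_max_le_right hn) M w g hg fun A h => hA A (by simp [h])
  | gen x φ _ ih =>
    obtain ⟨n₀, L, hL, h⟩ := ih
    refine ⟨max n₀ (x + 1), L, hL, fun n hn M w g hg hA v hv d hd => ?_⟩
    refine h n (le_of_max_le_left hn) M v _ (fun y => ?_) fun A hAL => ?_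
    · by_cases hyx : y = x
      · simpa [hyx] using hd
      · simpa [hyx] using M.dom_expanding _ _ hv (hg y)
    · rw [KripkeModel.forces_allBelow]
      intro u hu g' hd' hg'
      refine KripkeModel.forces_allBelow.1 (hA A hAL) u (M.trans _ _ _ hv hu) g' hd' fun y hy => ?_
      rw [hg' y hy, Function.update_of_ne]
      have := le_of_max_le_right hn
      omega

/-- A formula is in the logic axiomatized by `Ax` iff it follows in `QInt` from finitely many
generalized axioms. -/
theorem ext_iff_exists_chain {φ : Formula} :
    Ext Ax φ ↔ ∃ (n : ℕ) (L : List Formula), (∀ A ∈ L, A ∈ Ax) ∧ chain n L φ ∈ QInt := by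
  constructor
  · intro h
    obtain ⟨n, L, hL, h⟩ := h.exists_forces
    refine ⟨n, L, hL, mem_QInt_iff.2 fun M w g hg => ?_⟩
    exact KripkeModel.forces_chain fun v hv hA =>
      h n le_rfl M v g (fun x => M.dom_expanding _ _ hv (hg x)) hA
  · rintro ⟨n, L, hL, h⟩
    exact Ext.of_chain hL (.int _ h)

/-- The constant domain axioms `∀ x (φ ∨ ∀ x ψ) → ∀ x φ ∨ ∀ x ψ`. Here the side condition of
the scheme holds automatically, so that the instances can be enumerated without testing it. -/
def QuantifiedCdAxioms : Set Formula :=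
  {χ | ∃ (x : ℕ) (φ ψ : Formula), χ = ((φ.or (ψ.all x)).all x).imp ((φ.all x).or (ψ.all x))}

theorem Ext.of_quantifiedCd {φ : Formula} (h : Ext (LinAxioms ∪ QuantifiedCdAxioms) φ) :
    φ ∈ QLCcd := by
  refine h.of_axioms ?_
  rintro φ (hφ | ⟨x, φ, ψ, rfl⟩)
  · exact .ax _ (Or.inl hφ)
  · exact .ax _ (Or.inr ⟨x, φ, ψ.all x, by simp [freeVars], rfl⟩)

theorem mem_QLCcd_iff {φ : Formula} : φ ∈ QLCcd ↔ Ext (LinAxioms ∪ QuantifiedCdAxioms) φ := by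
  refine ⟨fun h => Ext.of_axioms ?_ h, Ext.of_quantifiedCd⟩
  rintro _ (h | ⟨x, φ, ψ, hx, rfl⟩)
  · exact .ax _ (Or.inl h)
  refine .mp _ _ (.int _ (mem_QInt_iff.2 fun M w g hg => ?_)) (.ax _ (Or.inr ⟨x, φ, ψ, rfl⟩))
  -- `ψ` and `∀ x ψ` are equivalent, as `x` is not free in `ψ`.
  have key : ∀ (v : M.World) (f : ℕ → M.Ind) d, M.Forces v (Function.update f x d) ψ ↔
      M.Forces v f ψ := fun v f d => KripkeModel.forces_congr fun y hy => by
    rw [Function.update_of_ne]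
    rintro rfl
    exact hx hy
  intro v hv hcd u hu h
  rcases hcd u hu fun t ht d hd => (h t ht d hd).imp id fun hψ s hs e _ =>
    (key _ _ _).2 (KripkeModel.Forces.mono hψ hs) with h' | h'
  · exact Or.inl h'
  · obtain ⟨d, hd⟩ := M.dom_nonempty u
    exact Or.inr ((key _ _ _).1 (h' u (M.refl u) d hd))

theorem QInt_subset_QLC : QInt ⊆ QLC := fun φ h => Ext.int φ h

theorem QLC_subset_QLCcd : QLC ⊆ QLCcd := fun _ h =>
  Ext.of_axioms (fun ψ hψ => Ext.ax ψ (Or.inl hψ)) h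

/-- `QLC.cd` is sound for the models with linearly ordered worlds in which every individual belongs
to every domain. -/
theorem forces_of_mem_QLCcd {M : KripkeModel} (hlin : ∀ u v, M.R u v ∨ M.R v u)
    (hdom : ∀ w d, d ∈ M.dom w) {φ : Formula} (h : φ ∈ QLCcd) (w : M.World) (g : ℕ → M.Ind) :
    M.Forces w g φ := by
  have h' : Ext (LinAxioms ∪ CdAxioms) φ := h
  clear h
  induction h' generalizing w g with
  | int φ hφ => exact hφ M w g fun x _ => hdom w _
  | ax φ hφ =>
    rcases hφ with ⟨φ, ψ, rfl⟩ | ⟨x, φ, ψ, hx, rfl⟩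
    · by_contra hcon
      simp only [KripkeModel.Forces, not_or, not_forall] at hcon
      obtain ⟨⟨u, hu, hφu, hψu⟩, v, hv, hψv, hφv⟩ := hcon
      rcases hlin u v with huv | hvu
      · exact hφv (hφu.mono huv)
      · exact hψu (hψv.mono hvu)
    · intro v _ hv
      by_cases hψ : M.Forces v g ψ
      · exact Or.inr hψ
      · refine Or.inl fun u hu d _ => ?_
        rcases hv v (M.refl v) d (hdom v d) with h | h
        · exact h.mono hu
        · refine absurd ((KripkeModel.forces_congr fun y hy => ?_).1 h) hψ
          rw [Function.update_of_ne]
          rintro rfl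
          exact hx hy
  | mp φ ψ _ _ ih₁ ih₂ => exact ih₁ w g w (M.refl w) (ih₂ w g)
  | gen x φ _ ih => exact fun v _ d _ => ih v _

end IntPred

namespace IntPred

open Turing.ToPartrec (Code)

/-! ### Two-variable Horn rules -/

/-- An injective numbering of the codes of partial recursive functions. -/
def codeIndex : Code → ℕ
  | .zero' => 0
  | .succ => 1
  | .tail => 2
  | .cons f g => 4 * Nat.pair (codeIndex f) (codeIndex g) + 3
  | .comp f g => 4 * Nat.pair (codeIndex f) (codeIndex g) + 4
  | .case f g => 4 * Nat.pair (codeIndex f) (codeIndex g) + 5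
  | .fix f => 4 * codeIndex f + 6

theorem codeIndex_injective : Function.Injective codeIndex := by
  intro c
  induction c with
  | zero' => intro d h; cases d <;> simp only [codeIndex] at h <;> first | rfl | omega
  | succ => intro d h; cases d <;> simp only [codeIndex] at h <;> first | rfl | omega
  | tail => intro d h; cases d <;> simp only [codeIndex] at h <;> first | rfl | omega
  | cons f g ihf ihg | comp f g ihf ihg | case f g ihf ihg =>
    intro d h
    cases d <;> simp only [codeIndex] at h <;> try omega
    have h' := Nat.pair_eq_pair.1 (mul_left_cancel₀ four_ne_zero (Nat.add_right_cancel h))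
    rw [ihf h'.1, ihg h'.2]
  | fix f ih =>
    intro d h
    cases d <;> simp only [codeIndex] at h <;> try omega
    exact congrArg Code.fix (ih (by omega))

/-- Attributes of individuals. In the intended structure the individuals are lists `v` of natural
numbers, and the attributes are `v` itself, its head, the successor of its head, its tail, and for
each code `c` the value of `c` at `v`, the head of that value, and the value of `c` at the
tail of `v`. -/
inductive Attr : Type
  | self | head | headSucc | tail
  | val (c : Code) | valHead (c : Code) | valTail (c : Code)

/-- Properties of individuals. In the intended structure the properties of a list `v` are: being
empty, being nonempty, having head `0`, having a positive head, having an empty tail, being in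
the domain of the code `c`, having its tail in the domain of `c`, and being `[k]`. -/
inductive Property : Type
  | nil | cons | zero | pos | tailNil
  | dom (c : Code) | domTail (c : Code) | singleton (k : ℕ)

/-- The index of the unary predicate letter for an attribute. Attributes have odd indices, properties
positive even ones. -/
def Attr.letter : Attr → ℕ
  | self => 1
  | head => 3
  | headSucc => 5
  | tail => 7
  | val c => 6 * codeIndex c + 9
  | valHead c => 6 * codeIndex c + 11
  | valTail c => 6 * codeIndex c + 13

/-- The index of the unary predicate letter for a property. -/
def Property.letter : Property → ℕ
  | nil => 2
  | cons => 4
  | zero => 6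
  | pos => 8
  | tailNil => 10
  | dom c => 6 * codeIndex c + 12
  | domTail c => 6 * codeIndex c + 14
  | singleton k => 6 * k + 16

theorem Attr.letter_injective : Function.Injective Attr.letter := by
  intro a b h
  cases a <;> cases b <;> simp only [letter] at h <;> first
    | rfl
    | omega
    | exact congrArg _ (codeIndex_injective (by omega))

theorem Property.letter_injective : Function.Injective Property.letter := by
  intro a b h
  cases a <;> cases b <;> simp only [letter] at h <;> first
    | rfl
    | omega
    | exact congrArg _ (codeIndex_injective (by omega))
    | (congr 1; omega)

theorem Attr.letter_mod_two (a : Attr) : a.letter % 2 = 1 := by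
  cases a <;> simp only [letter] <;> omega

theorem Property.letter_mod_two (p : Property) : p.letter % 2 = 0 := by
  cases p <;> simp only [letter] <;> omega

theorem Property.letter_ne_zero (p : Property) : p.letter ≠ 0 := by
  cases p <;> simp [letter]

/-- Atomic facts about two individuals, referred to by `0` and `1`: equality of two attributes, or
a property of one individual. -/
inductive Fact : Type
  | eq (a : Attr) (i : Fin 2) (b : Attr) (j : Fin 2)
  | is (p : Property) (i : Fin 2)

/-- Rules: `horn body head` says that any two individuals satisfying `body` satisfy `head`;
`exi head` says that for each individual `0` there is an individual `1` such that `head` holds. -/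
inductive Rule : Type
  | horn (body head : List Fact)
  | exi (head : List Fact)

/-- Structures with attributes taking values in `V`. -/
structure Str (V : Type) : Type 1 where
  Elem : Type
  nonempty : Nonempty Elem
  attr : Attr → Elem → V
  prop : Property → Elem → Prop

section Semantics

variable {V : Type} (S : Str V)

/-- Truth of a fact in a structure. -/
def Fact.Holds (e : Fin 2 → S.Elem) : Fact → Prop
  | eq a i b j => S.attr a (e i) = S.attr b (e j)
  | is p i => S.prop p (e i)

/-- Truth of a rule in a structure. -/
def Rule.Holds : Rule → Prop
  | horn body head => ∀ x y, (∀ F ∈ body, F.Holds S ![x, y]) → ∀ F ∈ head, F.Holds S ![x, y]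
  | exi head => ∀ x, ∃ y, ∀ F ∈ head, F.Holds S ![x, y]

end Semantics

/-! ### Rules as positive formulas -/

namespace Formula

/-- The formula that plays the role of falsity: the letter `0`, which expresses no attribute and no
property, applies to everything. -/
def falsum : Formula := .all 0 (.atom 0 [0])

/-- A positive formula true everywhere. -/
def verum : Formula := (Formula.atom 0 [0]).imp (.atom 0 [0])

end Formula

open Formula (falsum verum)

/-- The formula expressing a fact. Equality of attributes is equivalence of the corresponding
atomic formulas. -/
def Fact.toFormula : Fact → Formula
  | eq a i b j =>
    ((Formula.atom a.letter [i]).imp (.atom b.letter [j])).and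
      ((Formula.atom b.letter [j]).imp (.atom a.letter [i]))
  | is p i => .atom p.letter [i]

/-- The conjunction of a list of facts. -/
def factsFormula (l : List Fact) : Formula :=
  l.foldr (fun F φ => F.toFormula.and φ) verum

/-- The formula expressing a rule. The disjunct `falsum` makes the formula of a Horn rule true
wherever `falsum` is; at the worlds of `Str.linearModel` beyond the root, attributes with
different values can become equivalent, so that there the rule itself may fail. -/
def Rule.toFormula : Rule → Formula
  | horn body head =>
    .all 0 (.all 1 ((factsFormula body).imp ((factsFormula head).or falsum)))
  | exi head => .all 0 (.ex 1 (factsFormula head))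

/-- The conjunction of a list of rules. -/
def rulesFormula (l : List Rule) : Formula :=
  l.foldr (fun r φ => r.toFormula.and φ) verum

theorem Fact.positive_restricted (F : Fact) :
    F.toFormula.Positive ∧ F.toFormula.Restricted := by
  have h (i : Fin 2) : (i : ℕ) ≤ 1 := Nat.le_of_lt_succ i.is_lt
  cases F <;> simp [toFormula, Formula.Positive, Formula.Restricted, h]

theorem factsFormula_positive_restricted (l : List Fact) :
    (factsFormula l).Positive ∧ (factsFormula l).Restricted := by
  induction l with
  | nil => simp [factsFormula, verum, Formula.Positive, Formula.Restricted]
  | cons F l ih =>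
    exact ⟨⟨F.positive_restricted.1, ih.1⟩, ⟨F.positive_restricted.2, ih.2⟩⟩

theorem falsum_positive_restricted : falsum.Positive ∧ falsum.Restricted := by
  simp [falsum, Formula.Positive, Formula.Restricted]

theorem Rule.positive_restricted (r : Rule) :
    r.toFormula.Positive ∧ r.toFormula.Restricted := by
  cases r with
  | horn body head =>
    have h₁ := factsFormula_positive_restricted body
    have h₂ := factsFormula_positive_restricted head
    have h₃ := falsum_positive_restricted
    simp [toFormula, Formula.Positive, Formula.Restricted, h₁, h₂, h₃]
  | exi head =>
    have h := factsFormula_positive_restricted head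
    simp [toFormula, Formula.Positive, Formula.Restricted, h]

theorem rulesFormula_positive_restricted (l : List Rule) :
    (rulesFormula l).Positive ∧ (rulesFormula l).Restricted := by
  induction l with
  | nil => simp [rulesFormula, verum, Formula.Positive, Formula.Restricted]
  | cons r l ih =>
    exact ⟨⟨r.positive_restricted.1, ih.1⟩, ⟨r.positive_restricted.2, ih.2⟩⟩

theorem KripkeModel.forces_verum {M : KripkeModel} {w : M.World} {g : ℕ → M.Ind} :
    M.Forces w g verum := fun _ _ h => h

/-! ### The structure at a world of a Kripke model -/

/-- The structure described by the letters at the world `w`: the value of an attribute at `d` is the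
set of the worlds above `w` at which the corresponding atomic formula is true of `d`. -/
def KripkeModel.str (M : KripkeModel) (w : M.World) : Str (Set M.World) where
  Elem := {d // d ∈ M.dom w}
  nonempty := (M.dom_nonempty w).to_subtype
  attr a d := {v | M.R w v ∧ [d.1] ∈ M.interp v a.letter}
  prop p d := [d.1] ∈ M.interp w p.letter

section Kripke

variable {M : KripkeModel} {w : M.World} {g : ℕ → M.Ind}

theorem Fact.forces_iff {e : Fin 2 → (M.str w).Elem} (he : ∀ i : Fin 2, g i = (e i).1)
    (F : Fact) : M.Forces w g F.toFormula ↔ F.Holds (M.str w) e := by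
  cases F with
  | eq a i b j =>
    simp only [toFormula, KripkeModel.Forces, Holds, KripkeModel.str, List.map_cons, List.map_nil,
      he, Set.ext_iff, Set.mem_ofPred_eq]
    constructor
    · rintro ⟨h₁, h₂⟩ v
      exact ⟨fun h => ⟨h.1, h₁ v h.1 h.2⟩, fun h => ⟨h.1, h₂ v h.1 h.2⟩⟩
    · exact fun h => ⟨fun v hv ha => ((h v).1 ⟨hv, ha⟩).2, fun v hv hb => ((h v).2 ⟨hv, hb⟩).2⟩
  | is p i => simp [toFormula, KripkeModel.Forces, Holds, KripkeModel.str, he]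

theorem forces_factsFormula_iff {e : Fin 2 → (M.str w).Elem} (he : ∀ i : Fin 2, g i = (e i).1)
    (l : List Fact) :
    M.Forces w g (factsFormula l) ↔ ∀ F ∈ l, F.Holds (M.str w) e := by
  induction l with
  | nil => exact ⟨fun _ _ h => (List.not_mem_nil h).elim, fun _ => KripkeModel.forces_verum⟩
  | cons F l ih =>
    rw [List.forall_mem_cons, ← ih, ← F.forces_iff he]
    rfl

theorem update_update_eq {α : Type} (g : ℕ → α) {P : α → Prop} (x y : {d // P d}) (i : Fin 2) :
    Function.update (Function.update g 0 x.1) 1 y.1 i = ((![x, y] : Fin 2 → {d // P d}) i).1 := by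
  fin_cases i <;> simp

/-- At worlds where `falsum` fails, the rules behave classically: whether a fact holds is decided by
the structure at the world. -/
theorem Rule.holds_of_forces (hq : ¬ M.Forces w g falsum) {r : Rule}
    (h : M.Forces w g r.toFormula) : r.Holds (M.str w) := by
  cases r with
  | horn body head =>
    intro x y hb
    have := h w (M.refl w) x.1 x.2 w (M.refl w) y.1 y.2 w (M.refl w)
      ((forces_factsFormula_iff (e := ![x, y]) (update_update_eq g x y) body).2 hb)
    rcases this with hh | hh
    · exact (forces_factsFormula_iff (e := ![x, y]) (update_update_eq g x y) head).1 hh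
    · exact (hq ((KripkeModel.forces_congr (by simp [falsum, Formula.freeVars])).1 hh)).elim
  | exi head =>
    intro x
    obtain ⟨d, hd, h⟩ := h w (M.refl w) x.1 x.2
    exact ⟨⟨d, hd⟩,
      (forces_factsFormula_iff (e := ![x, ⟨d, hd⟩]) (update_update_eq g x ⟨d, hd⟩) head).1 h⟩

theorem holds_of_forces_rulesFormula (hq : ¬ M.Forces w g falsum) {l : List Rule}
    (h : M.Forces w g (rulesFormula l)) : ∀ r ∈ l, r.Holds (M.str w) := by
  induction l with
  | nil => simp
  | cons r l ih =>
    rw [List.forall_mem_cons]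
    exact ⟨r.holds_of_forces hq h.1, ih h.2⟩

end Kripke

/-! ### The linear Kripke model of a structure -/

/-- The Kripke model of a structure with natural numbers as values. The worlds form the chain of
the natural numbers and all individuals exist everywhere. The value `n` is turned into the
up-set of the worlds above `n`; all these up-sets miss the root `0`. Beyond the root, the formula
`falsum` and all properties become true. -/
def Str.linearModel (S : Str ℕ) : KripkeModel where
  World := ℕ
  world_nonempty := ⟨0⟩
  R := (· ≤ ·)
  refl := le_refl
  trans _ _ _ := le_trans
  antisymm _ _ := le_antisymm
  Ind := S.Elem
  dom _ := Set.univ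
  dom_nonempty _ := S.nonempty.elim fun e => ⟨e, Set.mem_univ e⟩
  dom_expanding _ _ _ := Set.Subset.rfl
  interp w k := {l | (k = 0 ∧ 0 < w) ∨ (∃ a e, k = Attr.letter a ∧ l = [e] ∧ S.attr a e < w) ∨
    ∃ p e, k = Property.letter p ∧ l = [e] ∧ (0 < w ∨ S.prop p e)}
  interp_dom _ _ _ _ _ _ := Set.mem_univ _
  interp_hereditary u w h k l hl := by
    rcases hl with ⟨hk, hu⟩ | ⟨a, e, hk, hl, ha⟩ | ⟨p, e, hk, hl, hp⟩
    · exact Or.inl ⟨hk, hu.trans_le h⟩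
    · exact Or.inr (Or.inl ⟨a, e, hk, hl, ha.trans_le h⟩)
    · exact Or.inr (Or.inr ⟨p, e, hk, hl, hp.imp_left (·.trans_le h)⟩)

section Linear

variable {S : Str ℕ}

theorem Str.mem_interp_attr (w : ℕ) (a : Attr) (e : S.Elem) :
    [e] ∈ S.linearModel.interp w a.letter ↔ S.attr a e < w := by
  constructor
  · rintro (⟨hk, -⟩ | ⟨b, e', hk, hl, hb⟩ | ⟨p, e', hk, -⟩)
    · have := a.letter_mod_two; omega
    · obtain rfl := Attr.letter_injective hk
      obtain rfl : e = e' := by simpa using hl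
      exact hb
    · have := a.letter_mod_two; have := p.letter_mod_two; omega
  · exact fun h => Or.inr (Or.inl ⟨a, e, rfl, rfl, h⟩)

theorem Str.mem_interp_prop (w : ℕ) (p : Property) (e : S.Elem) :
    [e] ∈ S.linearModel.interp w p.letter ↔ 0 < w ∨ S.prop p e := by
  constructor
  · rintro (⟨hk, -⟩ | ⟨b, e', hk, -⟩ | ⟨p', e', hk, hl, hp⟩)
    · exact (p.letter_ne_zero hk).elim
    · have := b.letter_mod_two; have := p.letter_mod_two; omega
    · obtain rfl := Property.letter_injective hk
      obtain rfl : e = e' := by simpa using hl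
      exact hp
  · exact fun h => Or.inr (Or.inr ⟨p, e, rfl, rfl, h⟩)

theorem Str.mem_interp_zero (w : ℕ) (l : List S.Elem) :
    l ∈ S.linearModel.interp w 0 ↔ 0 < w := by
  constructor
  · rintro (⟨-, h⟩ | ⟨b, e', hk, -⟩ | ⟨p, e', hk, -⟩)
    · exact h
    · have := b.letter_mod_two; omega
    · exact (p.letter_ne_zero hk.symm).elim
  · exact fun h => Or.inl ⟨rfl, h⟩

theorem Str.linearModel_forces_falsum {w : ℕ} {g : ℕ → S.Elem} :
    S.linearModel.Forces w g falsum ↔ 0 < w := by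
  constructor
  · intro h
    obtain ⟨e⟩ := S.nonempty
    exact (S.mem_interp_zero w _).1 (h w le_rfl e (Set.mem_univ _))
  · exact fun h v hv d _ => (S.mem_interp_zero v _).2 (h.trans_le hv)

theorem Fact.linearModel_forces_iff {g : ℕ → S.Elem} {e : Fin 2 → S.Elem}
    (he : ∀ i : Fin 2, g i = e i) (F : Fact) :
    S.linearModel.Forces (0 : ℕ) g F.toFormula ↔ F.Holds S e := by
  have hattr (v : ℕ) (a : Attr) (i : Fin 2) :
      S.linearModel.Forces v g (.atom a.letter [i]) ↔ S.attr a (e i) < v :=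
    he i ▸ S.mem_interp_attr v a (g i)
  cases F with
  | eq a i b j =>
    constructor
    · rintro ⟨h₁, h₂⟩
      exact le_antisymm
        (Nat.lt_succ_iff.1 ((hattr _ _ _).1 (h₂ _ (Nat.zero_le _)
          ((hattr _ _ _).2 (Nat.lt_succ_self _)))))
        (Nat.lt_succ_iff.1 ((hattr _ _ _).1 (h₁ _ (Nat.zero_le _)
          ((hattr _ _ _).2 (Nat.lt_succ_self _)))))
    · intro h
      have h : S.attr a (e i) = S.attr b (e j) := h
      exact ⟨fun v _ hv => (hattr v b j).2 (h ▸ (hattr v a i).1 hv),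
        fun v _ hv => (hattr v a i).2 (h ▸ (hattr v b j).1 hv)⟩
  | is p i =>
    have : S.linearModel.Forces (0 : ℕ) g (.atom p.letter [i]) ↔ 0 < 0 ∨ S.prop p (e i) :=
      he i ▸ S.mem_interp_prop 0 p (g i)
    exact this.trans (by simp [Holds])

theorem linearModel_forces_factsFormula_iff {g : ℕ → S.Elem} {e : Fin 2 → S.Elem}
    (he : ∀ i : Fin 2, g i = e i) (l : List Fact) :
    S.linearModel.Forces (0 : ℕ) g (factsFormula l) ↔ ∀ F ∈ l, F.Holds S e := by
  induction l with
  | nil => exact ⟨fun _ _ h => (List.not_mem_nil h).elim, fun _ => KripkeModel.forces_verum⟩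
  | cons F l ih =>
    rw [List.forall_mem_cons, ← ih, ← F.linearModel_forces_iff he]
    rfl

theorem update_update_apply {α : Type} (g : ℕ → α) (x y : α) (i : Fin 2) :
    Function.update (Function.update g 0 x) 1 y i = (![x, y] : Fin 2 → α) i := by
  fin_cases i <;> simp

/-- A rule true in a structure is true at the root of its linear Kripke model: at the root the
formulas of facts have their intended meaning, and beyond it `falsum` is true. -/
theorem Rule.linearModel_forces {g : ℕ → S.Elem} {r : Rule} (h : r.Holds S) :
    S.linearModel.Forces (0 : ℕ) g r.toFormula := by
  cases r with
  | horn body head =>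
    intro u _ x _ v huv y _ w hvw hb
    rcases Nat.eq_zero_or_pos w with rfl | hw
    · obtain rfl : v = (0 : ℕ) := Nat.le_zero.1 hvw
      refine Or.inl ((linearModel_forces_factsFormula_iff (update_update_apply g x y) head).2 ?_)
      exact h x y ((linearModel_forces_factsFormula_iff (update_update_apply g x y) body).1 hb)
    · exact Or.inr (Str.linearModel_forces_falsum.2 hw)
  | exi head =>
    intro u hu x _
    obtain ⟨y, hy⟩ := h x
    refine ⟨y, Set.mem_univ _, ?_⟩
    exact KripkeModel.Forces.mono
      ((linearModel_forces_factsFormula_iff (update_update_apply g x y) head).2 hy) hu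

theorem linearModel_forces_rulesFormula {g : ℕ → S.Elem} {l : List Rule}
    (h : ∀ r ∈ l, r.Holds S) : S.linearModel.Forces (0 : ℕ) g (rulesFormula l) := by
  induction l with
  | nil => exact KripkeModel.forces_verum
  | cons r l ih =>
    rw [List.forall_mem_cons] at h
    exact ⟨r.linearModel_forces h.1, ih h.2⟩

end Linear

end IntPred

namespace IntPred

open Turing.ToPartrec (Code)
open Formula (falsum)

/-! ### The Horn theory of a partial recursive function -/

open IntPred.Fact IntPred.Rule

/-- Rules for the building blocks of lists: they provide a row for the empty list, for `0 :: v`, and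
for `(v.headI + 1) :: v.tail`. -/
def listRules : List Rule :=
  [exi [is .nil 1],
   exi [is .cons 1, is .zero 1, eq .tail 1 .self 0],
   exi [is .cons 1, eq .tail 1 .tail 0, eq .head 1 .headSucc 0],
   horn [is .nil 0] [is .zero 0, eq .tail 0 .self 0],
   horn [is .zero 0, is .zero 1] [eq .head 0 .head 1],
   horn [eq .head 0 .head 1] [eq .headSucc 0 .headSucc 1],
   horn [eq .head 0 .headSucc 1] [is .pos 0],
   horn [is .nil 0, eq .tail 1 .self 0] [is .tailNil 1]]

/-- Rules computing the values of a code and of its subcodes, following the recursive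
definition of `Code.eval`. The value of `fix f` at `v` is the tail of `f v` or the value of
`fix f` at the tail of `f v`; the attribute `valTail (fix f)` of `f v` is the latter. -/
def codeRules : Code → List Rule
  | .zero' =>
    [horn [is .cons 1, is .zero 1, eq .tail 1 .self 0]
      [is (.dom .zero') 0, eq (.val .zero') 0 .self 1]]
  | .succ =>
    [horn [is .cons 1, is .tailNil 1, eq .head 1 .headSucc 0]
      [is (.dom .succ) 0, eq (.val .succ) 0 .self 1]]
  | .tail =>
    [horn [] [is (.dom .tail) 0, eq (.val .tail) 0 .tail 0]]
  | .cons f g =>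
    [horn [is (.dom f) 0, eq .self 1 (.val f) 0] [eq (.valHead (.cons f g)) 0 .head 1],
     horn [is (.dom f) 0, is (.dom g) 0, is .cons 1, eq .head 1 (.valHead (.cons f g)) 0,
        eq .tail 1 (.val g) 0]
      [is (.dom (.cons f g)) 0, eq (.val (.cons f g)) 0 .self 1]] ++ codeRules f ++ codeRules g
  | .comp f g =>
    [horn [is (.dom g) 0, eq .self 1 (.val g) 0, is (.dom f) 1]
      [is (.dom (.comp f g)) 0, eq (.val (.comp f g)) 0 (.val f) 1]] ++ codeRules f ++ codeRules g
  | .case f g =>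
    [horn [is .zero 0, eq .self 1 .tail 0, is (.dom f) 1]
      [is (.dom (.case f g)) 0, eq (.val (.case f g)) 0 (.val f) 1],
     horn [is .cons 1, eq .headSucc 1 .head 0, eq .tail 1 .tail 0, is (.dom g) 1]
      [is (.dom (.case f g)) 0, eq (.val (.case f g)) 0 (.val g) 1]] ++ codeRules f ++ codeRules g
  | .fix f =>
    [horn [is (.dom f) 0, eq .self 1 (.val f) 0, is .zero 1]
      [is (.dom (.fix f)) 0, eq (.val (.fix f)) 0 .tail 1],
     horn [is (.dom f) 0, eq .self 1 (.val f) 0, is .pos 1, is (.domTail (.fix f)) 1]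
      [is (.dom (.fix f)) 0, eq (.val (.fix f)) 0 (.valTail (.fix f)) 1],
     horn [eq .self 1 .tail 0, is (.dom (.fix f)) 1]
      [is (.domTail (.fix f)) 0, eq (.valTail (.fix f)) 0 (.val (.fix f)) 1]] ++ codeRules f

/-- The rule identifying the list `[0]`. -/
def singletonZeroRule : Rule :=
  horn [is .cons 0, is .zero 0, is .tailNil 0] [is (.singleton 0) 0]

/-- The rule identifying the list `[k + 1]`, given `[k]`. -/
def singletonSuccRule (k : ℕ) : Rule :=
  horn [is (.singleton k) 0, is .cons 1, eq .head 1 .headSucc 0, eq .tail 1 .tail 0]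
    [is (.singleton (k + 1)) 1]

/-! ### Computations in structures satisfying the rules -/

section Derivation

variable {V : Type} {S : Str V}

/-- `rep` assigns to each list an individual with the attributes and properties of this list. -/
structure IsRep (S : Str V) (num : ℕ → V) (rep : List ℕ → S.Elem) : Prop where
  head (v) : S.attr .head (rep v) = num v.headI
  headSucc (v) : S.attr .headSucc (rep v) = num (v.headI + 1)
  tail (v) : S.attr .tail (rep v) = S.attr .self (rep v.tail)
  cons (a v) : S.prop .cons (rep (a :: v))
  zero (v) : v.headI = 0 → S.prop .zero (rep v)
  pos (v) : v.headI ≠ 0 → S.prop .pos (rep v)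
  tailNil (v) : v.tail = [] → S.prop .tailNil (rep v)

/-- The lists are represented by iterating the two existential rules, starting from an empty list. -/
theorem exists_isRep (h : ∀ r ∈ listRules, r.Holds S) :
    ∃ (num : ℕ → V) (rep : List ℕ → S.Elem), IsRep S num rep := by
  simp only [listRules, List.forall_mem_cons, Rule.Holds, Fact.Holds, List.not_mem_nil,
    IsEmpty.forall_iff, implies_true, and_true, Matrix.cons_val_zero, Matrix.cons_val_one,
    and_imp] at h
  obtain ⟨hnil, hc0, hcs, hnz, hz, hhs, hp, hn⟩ := h
  choose nil hnil using hnil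
  choose c0 hc0 using hc0
  choose cs hcs using hcs
  obtain ⟨e⟩ := S.nonempty
  obtain ⟨rep, rep_nil, rep_zero, rep_succ⟩ : ∃ rep : List ℕ → S.Elem, rep [] = nil e ∧
      (∀ v, rep (0 :: v) = c0 (rep v)) ∧ ∀ a v, rep ((a + 1) :: v) = cs (rep (a :: v)) :=
    ⟨fun v => List.rec (nil e) (fun a _ r => Nat.rec (c0 r) (fun _ s => cs s) a) v, rfl,
      fun _ => rfl, fun _ _ => rfl⟩
  have hzero : ∀ v : List ℕ, v.headI = 0 → S.prop .zero (rep v) := by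
    rintro (_ | ⟨a, v⟩) hv
    · exact rep_nil ▸ (hnz _ e (hnil e)).1
    · obtain rfl : a = 0 := hv
      exact rep_zero v ▸ (hc0 (rep v)).2.1
  have hhead : ∀ a u v, S.attr .head (rep (a :: u)) = S.attr .head (rep (a :: v)) := by
    intro a u v
    induction a with
    | zero => exact hz _ _ (hzero (0 :: u) rfl) (hzero (0 :: v) rfl)
    | succ a ih => rw [rep_succ, rep_succ, (hcs _).2.2, (hcs _).2.2, hhs _ _ ih]
  have hhead' : ∀ v : List ℕ, S.attr .head (rep v) = S.attr .head (rep [v.headI]) := by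
    rintro (_ | ⟨a, v⟩)
    · exact hz _ _ (hzero [] rfl) (hzero [0] rfl)
    · exact hhead a v []
  have htail : ∀ v : List ℕ, S.attr .tail (rep v) = S.attr .self (rep v.tail) := by
    rintro (_ | ⟨a, v⟩)
    · exact rep_nil ▸ (hnz _ e (hnil e)).2
    · induction a with
      | zero => exact rep_zero v ▸ (hc0 (rep v)).2.2
      | succ a ih => exact rep_succ a v ▸ (hcs _).2.1.trans ih
  refine ⟨fun n => S.attr .head (rep [n]), rep, hhead', fun v => ?_, htail, ?_, hzero, ?_, ?_⟩
  · exact (hhs _ _ (hhead' v)).trans (rep_succ _ _ ▸ (hcs _).2.2.symm)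
  · intro a v
    cases a with
    | zero => exact rep_zero v ▸ (hc0 (rep v)).1
    | succ a => exact rep_succ a v ▸ (hcs _).1
  · rintro (_ | ⟨_ | a, v⟩) hv
    · exact (hv rfl).elim
    · exact (hv rfl).elim
    · exact hp _ _ (rep_succ a v ▸ (hcs (rep (a :: v))).2.2)
  · intro v hv
    refine hn (rep []) _ (rep_nil ▸ hnil e) ?_
    rw [htail, hv]

/-- In a structure satisfying the rules, a value of a code at a list is the value recorded at the
individual representing this list. -/
theorem IsRep.eval {num : ℕ → V} {rep : List ℕ → S.Elem} (hr : IsRep S num rep) {c : Code}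
    (h : ∀ r ∈ codeRules c, r.Holds S) {u v : List ℕ} (huv : u ∈ c.eval v) :
    S.prop (.dom c) (rep v) ∧ S.attr (.val c) (rep v) = S.attr .self (rep u) := by
  induction c generalizing u v with
  | zero' =>
    simp only [codeRules, List.forall_mem_cons, Rule.Holds, Fact.Holds, List.not_mem_nil,
      IsEmpty.forall_iff, implies_true, and_true, Matrix.cons_val_zero, Matrix.cons_val_one,
      and_imp] at h
    obtain rfl : u = 0 :: v := by simpa using huv
    exact h _ _ (hr.cons _ _) (hr.zero _ rfl) (hr.tail _)
  | succ =>
    simp only [codeRules, List.forall_mem_cons, Rule.Holds, Fact.Holds, List.not_mem_nil,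
      IsEmpty.forall_iff, implies_true, and_true, Matrix.cons_val_zero, Matrix.cons_val_one,
      and_imp] at h
    obtain rfl : u = [v.headI + 1] := by simpa using huv
    exact h _ _ (hr.cons _ _) (hr.tailNil _ rfl) ((hr.head _).trans (hr.headSucc _).symm)
  | tail =>
    simp only [codeRules, List.forall_mem_cons, Rule.Holds, Fact.Holds, List.not_mem_nil,
      IsEmpty.forall_iff, implies_true, and_true, Matrix.cons_val_zero,
      forall_const] at h
    obtain rfl : u = v.tail := by simpa using huv
    have := h (rep v) (rep v)
    exact ⟨this.1, this.2.trans (hr.tail _)⟩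
  | cons f g ihf ihg =>
    simp only [codeRules, List.forall_mem_append, List.forall_mem_cons, Rule.Holds, Fact.Holds,
      List.not_mem_nil, IsEmpty.forall_iff, implies_true, and_true, Matrix.cons_val_zero,
      Matrix.cons_val_one, and_imp] at h
    obtain ⟨⟨⟨h₁, h₂⟩, hf⟩, hg⟩ := h
    obtain ⟨a, ha, b, hb, rfl⟩ : ∃ a ∈ f.eval v, ∃ b ∈ g.eval v, u = a.headI :: b := by
      simpa using huv
    obtain ⟨hf₁, hf₂⟩ := ihf hf ha
    obtain ⟨hg₁, hg₂⟩ := ihg hg hb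
    refine h₂ _ _ hf₁ hg₁ (hr.cons _ _) ?_ ((hr.tail _).trans hg₂.symm)
    rw [h₁ _ _ hf₁ hf₂.symm, hr.head, hr.head]
    rfl
  | comp f g ihf ihg =>
    simp only [codeRules, List.forall_mem_append, List.forall_mem_cons, Rule.Holds, Fact.Holds,
      List.not_mem_nil, IsEmpty.forall_iff, implies_true, and_true, Matrix.cons_val_zero,
      Matrix.cons_val_one, and_imp] at h
    obtain ⟨⟨h₁, hf⟩, hg⟩ := h
    obtain ⟨a, ha, hu⟩ : ∃ a ∈ g.eval v, u ∈ f.eval a := by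
      rw [Code.comp_eval] at huv
      exact Part.mem_bind_iff.1 huv
    obtain ⟨hg₁, hg₂⟩ := ihg hg ha
    obtain ⟨hf₁, hf₂⟩ := ihf hf hu
    exact (h₁ _ _ hg₁ hg₂.symm hf₁).imp_right (·.trans hf₂)
  | case f g ihf ihg =>
    simp only [codeRules, List.forall_mem_append, List.forall_mem_cons, Rule.Holds, Fact.Holds,
      List.not_mem_nil, IsEmpty.forall_iff, implies_true, and_true, Matrix.cons_val_zero,
      Matrix.cons_val_one, and_imp] at h
    obtain ⟨⟨⟨h₁, h₂⟩, hf⟩, hg⟩ := h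
    rw [Code.case_eval] at huv
    cases hv : v.headI with
    | zero =>
      simp only [hv] at huv
      obtain ⟨hf₁, hf₂⟩ := ihf hf huv
      exact (h₁ _ _ (hr.zero _ hv) (hr.tail _).symm hf₁).imp_right (·.trans hf₂)
    | succ n =>
      simp only [hv] at huv
      obtain ⟨hg₁, hg₂⟩ := ihg hg huv
      refine (h₂ _ _ (hr.cons _ _) ?_ ?_ hg₁).imp_right (·.trans hg₂)
      · rw [hr.headSucc, hr.head, hv]
        rfl
      · rw [hr.tail, hr.tail]
        rfl
  | fix f ih =>
    simp only [codeRules, List.forall_mem_append, List.forall_mem_cons, Rule.Holds, Fact.Holds,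
      List.not_mem_nil, IsEmpty.forall_iff, implies_true, and_true, Matrix.cons_val_zero,
      Matrix.cons_val_one, and_imp] at h
    obtain ⟨⟨h₁, h₂, h₃⟩, hf⟩ := h
    rw [Code.fix_eval] at huv
    refine PFun.fixInduction huv fun v hv IH => ?_
    rcases PFun.mem_fix_iff.1 hv with hu | ⟨w, hw, -⟩
    · obtain ⟨a, ha, hu⟩ := (Part.mem_map_iff _).1 hu
      obtain ⟨hf₁, hf₂⟩ := ih hf ha
      split_ifs at hu with h0
      obtain rfl : a.tail = u := by simpa using hu
      exact (h₁ _ _ hf₁ hf₂.symm (hr.zero _ h0)).imp_right (·.trans (hr.tail _))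
    · obtain ⟨hw₁, hw₂⟩ := IH w hw
      obtain ⟨a, ha, hu⟩ := (Part.mem_map_iff _).1 hw
      obtain ⟨hf₁, hf₂⟩ := ih hf ha
      split_ifs at hu with h0
      obtain rfl : a.tail = w := by simpa using hu
      obtain ⟨ht₁, ht₂⟩ := h₃ (rep a) _ (hr.tail a).symm hw₁
      obtain ⟨h₄, h₅⟩ := h₂ _ _ hf₁ hf₂.symm (hr.pos _ h0) ht₁
      exact ⟨h₄, h₅.trans (ht₂.trans hw₂)⟩

theorem IsRep.singleton {num : ℕ → V} {rep : List ℕ → S.Elem} (hr : IsRep S num rep) {n : ℕ}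
    (h0 : singletonZeroRule.Holds S) (hs : ∀ k < n, (singletonSuccRule k).Holds S) :
    S.prop (.singleton n) (rep [n]) := by
  simp only [singletonZeroRule, singletonSuccRule, List.forall_mem_cons, Rule.Holds, Fact.Holds,
    List.not_mem_nil, IsEmpty.forall_iff, implies_true, and_true, Matrix.cons_val_zero,
    Matrix.cons_val_one, and_imp] at h0 hs
  induction n with
  | zero => exact h0 _ (rep []) (hr.cons _ _) (hr.zero _ rfl) (hr.tailNil _ rfl)
  | succ n ih =>
    refine hs n n.lt_succ_self _ _ (ih fun k hk => hs k (by omega)) (hr.cons _ _) ?_ ?_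
    · rw [hr.head, hr.headSucc]
      rfl
    · rw [hr.tail, hr.tail]
      rfl

end Derivation

/-! ### The intended structure -/

open Classical in
/-- The structure of all lists of natural numbers; lists are turned into values by encoding, and
`0` is the value of a code where it is undefined. -/
noncomputable def listStr : Str ℕ where
  Elem := List ℕ
  nonempty := ⟨[]⟩
  attr
    | .self, v => Encodable.encode v
    | .head, v => v.headI
    | .headSucc, v => v.headI + 1
    | .tail, v => Encodable.encode v.tail
    | .val c, v => if h : (c.eval v).Dom then Encodable.encode ((c.eval v).get h) else 0
    | .valHead (.cons f _), v => if h : (f.eval v).Dom then ((f.eval v).get h).headI else 0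
    | .valHead _, _ => 0
    | .valTail c, v =>
      if h : (c.eval v.tail).Dom then Encodable.encode ((c.eval v.tail).get h) else 0
  prop
    | .nil, v => v = []
    | .cons, v => v ≠ []
    | .zero, v => v.headI = 0
    | .pos, v => v.headI ≠ 0
    | .tailNil, v => v.tail = []
    | .dom c, v => (c.eval v).Dom
    | .domTail c, v => (c.eval v.tail).Dom
    | .singleton k, v => v = [k]

theorem listStr_val {c : Code} {u v : List ℕ} (h : u ∈ c.eval v) :
    listStr.attr (.val c) v = Encodable.encode u := by
  obtain ⟨hd, rfl⟩ := h
  exact dif_pos hd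

theorem listStr_valTail {c : Code} {u v : List ℕ} (h : u ∈ c.eval v.tail) :
    listStr.attr (.valTail c) v = Encodable.encode u := by
  obtain ⟨hd, rfl⟩ := h
  exact dif_pos hd

theorem listStr_valHead {f g : Code} {u v : List ℕ} (h : u ∈ f.eval v) :
    listStr.attr (.valHead (.cons f g)) v = u.headI := by
  obtain ⟨hd, rfl⟩ := h
  exact dif_pos hd

theorem mem_eval_cons {f g : Code} {a b v : List ℕ} (ha : a ∈ f.eval v) (hb : b ∈ g.eval v) :
    a.headI :: b ∈ (Code.cons f g).eval v := by
  rw [Code.cons_eval]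
  exact Part.mem_bind ha (Part.mem_bind hb (Part.mem_some _))

theorem mem_eval_comp {f g : Code} {u v w : List ℕ} (hw : w ∈ g.eval v) (hu : u ∈ f.eval w) :
    u ∈ (Code.comp f g).eval v := by
  rw [Code.comp_eval]
  exact Part.mem_bind hw hu

theorem mem_eval_case_zero {f g : Code} {u v : List ℕ} (hv : v.headI = 0)
    (hu : u ∈ f.eval v.tail) : u ∈ (Code.case f g).eval v := by
  simp only [Code.case_eval, hv]
  exact hu

theorem mem_eval_case_succ {f g : Code} {u v : List ℕ} {n : ℕ} (hv : v.headI = n + 1)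
    (hu : u ∈ g.eval (n :: v.tail)) : u ∈ (Code.case f g).eval v := by
  simp only [Code.case_eval, hv]
  exact hu

theorem mem_eval_fix_zero {f : Code} {v w : List ℕ} (hw : w ∈ f.eval v) (h : w.headI = 0) :
    w.tail ∈ (Code.fix f).eval v := by
  rw [Code.fix_eval]
  exact PFun.mem_fix_iff.2 (Or.inl ((Part.mem_map_iff _).2 ⟨w, hw, if_pos h⟩))

theorem mem_eval_fix_ne_zero {f : Code} {u v w : List ℕ} (hw : w ∈ f.eval v) (h : w.headI ≠ 0)
    (hu : u ∈ (Code.fix f).eval w.tail) : u ∈ (Code.fix f).eval v := by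
  rw [Code.fix_eval] at hu ⊢
  exact PFun.mem_fix_iff.2 (Or.inr ⟨w.tail, (Part.mem_map_iff _).2 ⟨w, hw, if_neg h⟩, hu⟩)

theorem listStr_holds_listRules : ∀ r ∈ listRules, r.Holds listStr := by
  simp only [listRules, List.forall_mem_cons, Rule.Holds, Fact.Holds, List.not_mem_nil,
    IsEmpty.forall_iff, implies_true, and_true, Matrix.cons_val_zero, Matrix.cons_val_one,
    and_imp]
  refine ⟨fun _ => ⟨[], rfl⟩, fun v => ⟨0 :: v, List.cons_ne_nil _ _, rfl, rfl⟩,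
    fun v => ⟨(v.headI + 1) :: v.tail, List.cons_ne_nil _ _, rfl, rfl⟩, ?_, ?_, ?_, ?_, ?_⟩
  · rintro v _ rfl
    exact ⟨rfl, rfl⟩
  · intro u v (hu : u.headI = 0) (hv : v.headI = 0)
    exact hu.trans hv.symm
  · intro u v (h : u.headI = v.headI)
    exact congrArg (· + 1) h
  · intro u v (h : u.headI = v.headI + 1)
    exact show u.headI ≠ 0 from h ▸ Nat.succ_ne_zero _
  · rintro u v rfl h
    exact Encodable.encode_injective h

theorem listStr_holds_codeRules (c : Code) : ∀ r ∈ codeRules c, r.Holds listStr := by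
  have cons_of : ∀ {v : List ℕ}, v ≠ [] → v = v.headI :: v.tail := fun {v} hv =>
    (List.cons_head!_tail hv).symm
  induction c with
  | zero' =>
    simp only [codeRules, List.forall_mem_cons, Rule.Holds, Fact.Holds, List.not_mem_nil,
      IsEmpty.forall_iff, implies_true, and_true, Matrix.cons_val_zero, Matrix.cons_val_one,
      and_imp]
    intro v u (h₁ : u ≠ []) (h₂ : u.headI = 0) h₃
    have h₃ : u.tail = v := Encodable.encode_injective h₃
    have hu : u ∈ Code.zero'.eval v := by
      rw [cons_of h₁, h₂, h₃]
      exact Part.mem_some _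
    exact ⟨hu.1, listStr_val hu⟩
  | succ =>
    simp only [codeRules, List.forall_mem_cons, Rule.Holds, Fact.Holds, List.not_mem_nil,
      IsEmpty.forall_iff, implies_true, and_true, Matrix.cons_val_zero, Matrix.cons_val_one,
      and_imp]
    intro v u (h₁ : u ≠ []) (h₂ : u.tail = []) (h₃ : u.headI = v.headI + 1)
    have hu : u ∈ Code.succ.eval v := by
      rw [cons_of h₁, h₂, h₃]
      exact Part.mem_some _
    exact ⟨hu.1, listStr_val hu⟩
  | tail =>
    simp only [codeRules, List.forall_mem_cons, Rule.Holds, Fact.Holds, List.not_mem_nil,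
      IsEmpty.forall_iff, implies_true, and_true, Matrix.cons_val_zero,
      forall_const]
    intro v _
    have hu : v.tail ∈ Code.tail.eval v := by simp
    exact ⟨hu.1, listStr_val hu⟩
  | cons f g ihf ihg =>
    refine List.forall_mem_append.2 ⟨List.forall_mem_append.2 ⟨?_, ihf⟩, ihg⟩
    simp only [List.forall_mem_cons, Rule.Holds, Fact.Holds,
      List.not_mem_nil, IsEmpty.forall_iff, implies_true, and_true, Matrix.cons_val_zero,
      Matrix.cons_val_one, and_imp]
    constructor
    · intro v u hd h
      have ha := Part.get_mem hd
      rw [listStr_val ha] at h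
      rw [listStr_valHead ha, ← Encodable.encode_injective h]
      rfl
    · intro v u hdf hdg (h₁ : u ≠ []) h₂ h₃
      have ha := Part.get_mem hdf
      have hb := Part.get_mem hdg
      rw [listStr_valHead ha] at h₂
      rw [listStr_val hb] at h₃
      have h₃ := Encodable.encode_injective h₃
      have hu : u ∈ (Code.cons f g).eval v := by
        rw [cons_of h₁, h₃, show u.headI = _ from h₂]
        exact mem_eval_cons ha hb
      exact ⟨hu.1, listStr_val hu⟩
  | comp f g ihf ihg =>
    refine List.forall_mem_append.2 ⟨List.forall_mem_append.2 ⟨?_, ihf⟩, ihg⟩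
    simp only [List.forall_mem_cons, Rule.Holds, Fact.Holds,
      List.not_mem_nil, IsEmpty.forall_iff, implies_true, and_true, Matrix.cons_val_zero,
      Matrix.cons_val_one, and_imp]
    intro v w hg h hf
    have hw := Part.get_mem hg
    rw [listStr_val hw] at h
    rw [← Encodable.encode_injective h] at hw
    have hu := Part.get_mem hf
    have huv : (f.eval w).get hf ∈ (Code.comp f g).eval v := mem_eval_comp hw hu
    exact ⟨huv.1, (listStr_val huv).trans (listStr_val hu).symm⟩
  | case f g ihf ihg =>
    refine List.forall_mem_append.2 ⟨List.forall_mem_append.2 ⟨?_, ihf⟩, ihg⟩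
    simp only [List.forall_mem_cons, Rule.Holds, Fact.Holds,
      List.not_mem_nil, IsEmpty.forall_iff, implies_true, and_true, Matrix.cons_val_zero,
      Matrix.cons_val_one, and_imp]
    constructor
    · intro v w (h₁ : v.headI = 0) h hf
      obtain rfl : w = List.tail v := Encodable.encode_injective (α := List ℕ) h
      have hu := Part.get_mem hf
      have huv : (f.eval v.tail).get hf ∈ (Code.case f g).eval v := mem_eval_case_zero h₁ hu
      exact ⟨huv.1, (listStr_val huv).trans (listStr_val hu).symm⟩
    · intro v w (h₁ : w ≠ []) (h₂ : w.headI + 1 = v.headI) h₃ hg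
      have h₃ : w.tail = v.tail := Encodable.encode_injective h₃
      have hu := Part.get_mem hg
      have huv : (g.eval w).get hg ∈ (Code.case f g).eval v := by
        refine mem_eval_case_succ h₂.symm ?_
        rw [← h₃, ← cons_of h₁]
        exact hu
      exact ⟨huv.1, (listStr_val huv).trans (listStr_val hu).symm⟩
  | fix f ih =>
    refine List.forall_mem_append.2 ⟨?_, ih⟩
    simp only [List.forall_mem_cons, Rule.Holds, Fact.Holds,
      List.not_mem_nil, IsEmpty.forall_iff, implies_true, and_true, Matrix.cons_val_zero,
      Matrix.cons_val_one, and_imp]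
    refine ⟨?_, ?_, ?_⟩
    · intro v w hf h (h₀ : w.headI = 0)
      have hw := Part.get_mem hf
      rw [listStr_val hw] at h
      rw [← Encodable.encode_injective h] at hw
      have huv : w.tail ∈ (Code.fix f).eval v := mem_eval_fix_zero hw h₀
      exact ⟨huv.1, listStr_val huv⟩
    · intro v w hf h (h₀ : w.headI ≠ 0) hd
      have hw := Part.get_mem hf
      rw [listStr_val hw] at h
      rw [← Encodable.encode_injective h] at hw
      have hu := Part.get_mem hd
      have huv := mem_eval_fix_ne_zero hw h₀ hu
      exact ⟨huv.1, (listStr_val huv).trans (listStr_valTail hu).symm⟩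
    · intro v w h hd
      obtain rfl : w = List.tail v := Encodable.encode_injective (α := List ℕ) h
      have hu := Part.get_mem hd
      exact ⟨hd, (listStr_valTail hu).trans (listStr_val hu).symm⟩

theorem listStr_holds_singletonZeroRule : singletonZeroRule.Holds listStr := by
  simp only [singletonZeroRule, List.forall_mem_cons, Rule.Holds, Fact.Holds,
    List.not_mem_nil, IsEmpty.forall_iff, implies_true, and_true, Matrix.cons_val_zero, and_imp]
  rintro (_ | ⟨a, v⟩) _ h₁ (h₂ : _ = 0) (h₃ : _ = [])
  · exact (h₁ rfl).elim
  · obtain rfl : a = 0 := h₂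
    obtain rfl : v = [] := h₃
    rfl

theorem listStr_holds_singletonSuccRule (k : ℕ) : (singletonSuccRule k).Holds listStr := by
  simp only [singletonSuccRule, List.forall_mem_cons, Rule.Holds, Fact.Holds,
    List.not_mem_nil, IsEmpty.forall_iff, implies_true, and_true, Matrix.cons_val_zero,
    Matrix.cons_val_one, and_imp]
  rintro v (_ | ⟨a, w⟩) rfl h₁ (h₂ : _ = _ + 1) h₃
  · exact (h₁ rfl).elim
  · obtain rfl : a = k + 1 := h₂
    obtain rfl : w = [] := Encodable.encode_injective h₃
    rfl

/-! ### The reduction -/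

/-- The conjunction of the rules which identify the list `[n]`. -/
def inputFormula : ℕ → Formula
  | 0 => singletonZeroRule.toFormula
  | n + 1 => (inputFormula n).and (singletonSuccRule n).toFormula

/-- The formula saying that the code `c` is not defined at `[n]`: no individual has both the property
`singleton n` and the property `dom c`. -/
def goalFormula (c : Code) (n : ℕ) : Formula :=
  .all 0 (((Formula.atom (Property.singleton n).letter [0]).and
    (.atom (Property.dom c).letter [0])).imp falsum)

/-- The formula expressing that the rules refute that `c` is undefined at `[n]`. -/
def haltFormula (c : Code) (n : ℕ) : Formula :=
  (rulesFormula (listRules ++ codeRules c)).imp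
    ((inputFormula n).imp ((goalFormula c n).imp falsum))

theorem inputFormula_positive_restricted (n : ℕ) :
    (inputFormula n).Positive ∧ (inputFormula n).Restricted := by
  induction n with
  | zero => exact Rule.positive_restricted _
  | succ n ih =>
    have h := (singletonSuccRule n).positive_restricted
    exact ⟨⟨ih.1, h.1⟩, ih.2, h.2⟩

theorem haltFormula_positive_restricted (c : Code) (n : ℕ) :
    (haltFormula c n).Positive ∧ (haltFormula c n).Restricted := by
  have h₁ := rulesFormula_positive_restricted (listRules ++ codeRules c)
  have h₂ := inputFormula_positive_restricted n
  have h₃ := falsum_positive_restricted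
  simp [haltFormula, goalFormula, Formula.Positive, Formula.Restricted, h₁, h₂, h₃]

theorem holds_of_forces_inputFormula {M : KripkeModel} {w : M.World} {g : ℕ → M.Ind}
    (hq : ¬ M.Forces w g falsum) {n : ℕ} (h : M.Forces w g (inputFormula n)) :
    singletonZeroRule.Holds (M.str w) ∧ ∀ k < n, (singletonSuccRule k).Holds (M.str w) := by
  induction n with
  | zero => exact ⟨Rule.holds_of_forces hq h, by simp⟩
  | succ n ih =>
    refine ⟨(ih h.1).1, fun k hk => ?_⟩
    rcases Nat.lt_succ_iff_lt_or_eq.1 hk with hk | rfl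
    · exact (ih h.1).2 k hk
    · exact Rule.holds_of_forces hq h.2

/-- If `c` halts at `[n]`, then the rules derive this in the structure at any world where `falsum`
fails. -/
theorem haltFormula_mem_QInt {c : Code} {n : ℕ} (h : (c.eval [n]).Dom) :
    haltFormula c n ∈ QInt := by
  refine mem_QInt_iff.2 fun M w g _ u _ hrules v huv hinput t hvt hgoal => ?_
  by_contra hq
  have hrules := holds_of_forces_rulesFormula hq
    ((hrules.mono huv).mono hvt)
  obtain ⟨h0, hs⟩ := holds_of_forces_inputFormula hq (hinput.mono hvt)
  rw [List.forall_mem_append] at hrules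
  obtain ⟨num, rep, hr⟩ := exists_isRep hrules.1
  have h₁ := hr.singleton h0 hs
  have h₂ := (hr.eval hrules.2 (Part.get_mem h)).1
  have h₃ := hgoal t (M.refl t) (rep [n]).1 (rep [n]).2 t (M.refl t)
    ⟨h₁, h₂⟩
  exact hq ((KripkeModel.forces_congr (by simp [falsum, Formula.freeVars])).1 h₃)

/-- If `c` does not halt at `[n]`, then the linear Kripke model of `listStr` refutes the formula; its
worlds are linearly ordered and its domains constant. -/
theorem haltFormula_notMem_QLCcd {c : Code} {n : ℕ} (h : ¬ (c.eval [n]).Dom) :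
    haltFormula c n ∉ QLCcd := by
  intro hmem
  have hforce := forces_of_mem_QLCcd (M := listStr.linearModel) (fun u v => le_total (α := ℕ) u v)
    (fun _ _ => Set.mem_univ _) hmem (0 : ℕ) fun _ => ([] : List ℕ)
  have hinput : ∀ n, listStr.linearModel.Forces (0 : ℕ) (fun _ => ([] : List ℕ))
      (inputFormula n) := by
    intro n
    induction n with
    | zero => exact Rule.linearModel_forces listStr_holds_singletonZeroRule
    | succ n ih => exact ⟨ih, Rule.linearModel_forces (listStr_holds_singletonSuccRule n)⟩
  refine lt_irrefl 0 (Str.linearModel_forces_falsum.1 (hforce (0 : ℕ) le_rfl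
    (linearModel_forces_rulesFormula ?_) (0 : ℕ) le_rfl (hinput n) (0 : ℕ) le_rfl ?_))
  · exact List.forall_mem_append.2 ⟨listStr_holds_listRules, listStr_holds_codeRules c⟩
  · intro u _ v _ w huw ⟨h₁, h₂⟩
    rcases Nat.eq_zero_or_pos w with rfl | hw
    · have h₁ := (listStr.mem_interp_prop 0 (.singleton n) v).1 h₁
      have h₂ := (listStr.mem_interp_prop 0 (.dom c) v).1 h₂
      obtain rfl : v = [n] := h₁.resolve_left (lt_irrefl 0)
      exact (h (h₂.resolve_left (lt_irrefl 0))).elim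
    · exact Str.linearModel_forces_falsum.2 hw

end IntPred

namespace IntPred

/-! ### Primitive recursion on formulas -/

section Primrec

variable {α : Type*} [Primcodable α]

theorem primrec_code_op (i : ℕ) {f g : α → ℕ} (hf : Primrec f) (hg : Primrec g) :
    Primrec fun a => 6 * Nat.pair (f a) (g a) + i :=
  Primrec.nat_add.comp (Primrec.nat_mul.comp (Primrec.const 6) (Primrec₂.natPair.comp hf hg))
    (Primrec.const i)

theorem primrec_and {f g : α → Formula} (hf : Primrec f) (hg : Primrec g) :
    Primrec fun a => (f a).and (g a) :=
  Primrec.encode_iff.1 (primrec_code_op 2 (Primrec.encode.comp hf) (Primrec.encode.comp hg))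

theorem primrec_or {f g : α → Formula} (hf : Primrec f) (hg : Primrec g) :
    Primrec fun a => (f a).or (g a) :=
  Primrec.encode_iff.1 (primrec_code_op 3 (Primrec.encode.comp hf) (Primrec.encode.comp hg))

theorem primrec_imp {f g : α → Formula} (hf : Primrec f) (hg : Primrec g) :
    Primrec fun a => (f a).imp (g a) :=
  Primrec.encode_iff.1 (primrec_code_op 4 (Primrec.encode.comp hf) (Primrec.encode.comp hg))

theorem primrec_all {f : α → ℕ} {g : α → Formula} (hf : Primrec f) (hg : Primrec g) :
    Primrec fun a => (g a).all (f a) :=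
  Primrec.encode_iff.1 (primrec_code_op 5 hf (Primrec.encode.comp hg))

theorem primrec_ex {f : α → ℕ} {g : α → Formula} (hf : Primrec f) (hg : Primrec g) :
    Primrec fun a => (g a).ex (f a) :=
  Primrec.encode_iff.1 (primrec_code_op 6 hf (Primrec.encode.comp hg))

theorem primrec_atom {f : α → ℕ} {g : α → List ℕ} (hf : Primrec f) (hg : Primrec g) :
    Primrec fun a => Formula.atom (f a) (g a) :=
  Primrec.encode_iff.1 (primrec_code_op 1 hf (Primrec.encode.comp hg))

end Primrec

/-- A formula passes the check if its atomic subformulas satisfy `at'`, its bound variables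
satisfy `v`, and, unless `b` holds, `⊥` does not occur in it. -/
def Formula.check (b : Prop) (at' : ℕ → List ℕ → Prop) (v : ℕ → Prop) : Formula → Prop
  | bot => b
  | atom k l => at' k l
  | and φ ψ => φ.check b at' v ∧ ψ.check b at' v
  | or φ ψ => φ.check b at' v ∧ ψ.check b at' v
  | imp φ ψ => φ.check b at' v ∧ ψ.check b at' v
  | all x φ => v x ∧ φ.check b at' v
  | ex x φ => v x ∧ φ.check b at' v

theorem Formula.primrecPred_check {b : Prop} {at' : ℕ → List ℕ → Prop} {v : ℕ → Prop}
    (hat : PrimrecRel at') (hv : PrimrecPred v) : PrimrecPred (Formula.check b at' v) := by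
  classical
  -- The truth value at the code `l.length`, computed from the list `l` of the values at
  -- smaller codes.
  let g : List Bool → Bool := fun l =>
    let n := l.length
    let p := ((n - 1) / 6).unpair
    if n = 0 then decide b
    else if (n - 1) % 6 = 0 then decide (at' p.1 (Denumerable.ofNat (List ℕ) p.2))
    else if (n - 1) % 6 < 4 then l.getD p.1 false && l.getD p.2 false
    else decide (v p.1) && l.getD p.2 false
  have hn : Primrec fun l : List Bool => l.length - 1 :=
    Primrec.pred.comp Primrec.list_length
  have hm : Primrec fun l : List Bool => (l.length - 1) % 6 :=
    Primrec.nat_mod.comp hn (Primrec.const 6)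
  have hp : Primrec fun l : List Bool => ((l.length - 1) / 6).unpair :=
    Primrec.unpair.comp (Primrec.nat_div.comp hn (Primrec.const 6))
  have hp₁ := Primrec.fst.comp hp
  have hp₂ := Primrec.snd.comp hp
  have hl₁ := (Primrec.list_getD false).comp Primrec.id hp₁
  have hl₂ := (Primrec.list_getD false).comp Primrec.id hp₂
  have hg : Primrec g :=
    Primrec.ite (Primrec.eq.comp Primrec.list_length (Primrec.const 0)) (Primrec.const _) <|
      Primrec.ite (Primrec.eq.comp hm (Primrec.const 0))
        (hat.comp hp₁ ((Primrec.ofNat _).comp hp₂)).decide <|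
      Primrec.ite (Primrec.nat_lt.comp hm (Primrec.const 4)) (Primrec.and.comp hl₁ hl₂)
        (Primrec.and.comp (hv.comp hp₁).decide hl₂)
  let f : ℕ → Bool := fun n => decide ((Denumerable.ofNat Formula n).check b at' v)
  have hf : ∀ φ : Formula, f φ.code = true ↔ φ.check b at' v := fun φ => by
    simp only [f, ← Formula.encode_eq_code, Denumerable.ofNat_encode, decide_eq_true_iff]
  have H : ∀ n, g ((List.range n).map f) = f n := by
    intro n
    obtain ⟨φ, rfl⟩ := Formula.code_surjective n
    have hget : ∀ m < φ.code, ((List.range φ.code).map f).getD m false = f m := fun m hm => by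
      simp [List.getD, hm]
    have hle₁ := Nat.left_le_pair
    have hle₂ := Nat.right_le_pair
    rw [Bool.eq_iff_iff, hf]
    have hlt : ∀ {a b i : ℕ}, 0 < i → a < 6 * Nat.pair a b + i ∧ b < 6 * Nat.pair a b + i :=
      fun {a b i} hi => ⟨by have := hle₁ a b; omega, by have := hle₂ a b; omega⟩
    have hdiv : ∀ a i : ℕ, i < 6 →
        (6 * a + (i + 1) - 1) / 6 = a ∧ (6 * a + (i + 1) - 1) % 6 = i := by
      omega
    cases φ with
    | bot => simp [g, Formula.code, Formula.check]
    | atom k l =>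
      simp [g, Formula.code, Formula.check]
    | and φ ψ | or φ ψ | imp φ ψ =>
      simp only [Formula.code] at hget
      have h₁ := hget _ (hlt (by omega)).1
      have h₂ := hget _ (hlt (by omega)).2
      simp only [g, List.length_map, List.length_range, Formula.code]
      rw [(hdiv _ _ (by omega)).1, (hdiv _ _ (by omega)).2, Nat.unpair_pair, h₁, h₂]
      simp [Formula.check, hf]
    | all x φ | ex x φ =>
      simp only [Formula.code] at hget
      have h₂ := hget _ (hlt (by omega)).2
      simp only [g, List.length_map, List.length_range, Formula.code]
      rw [(hdiv _ _ (by omega)).1, (hdiv _ _ (by omega)).2, Nat.unpair_pair, h₂]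
      simp [Formula.check, hf]
  have hfprim : Primrec₂ fun (_ : Unit) n => f n :=
    Primrec.nat_strong_rec (fun _ => f) (Primrec.option_some.comp (hg.comp Primrec.snd)).to₂
      fun _ n => congrArg some (H n)
  have := (hfprim.comp (Primrec.const ()) Primrec.id).comp (Primrec.encode (α := Formula))
  exact Primrec.primrecPred (this.of_eq fun φ =>
    Bool.eq_iff_iff.2 ((hf φ).trans decide_eq_true_iff.symm))

theorem primrecPred_positive : PrimrecPred Formula.Positive := by
  refine (Formula.primrecPred_check (b := False) (at' := fun _ _ => True) (v := fun _ => True)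
    (PrimrecPred.of_eq (p := fun _ => True) ⟨inferInstance, Primrec.const _⟩ fun _ => Iff.rfl)
    ⟨inferInstance, Primrec.const _⟩).of_eq fun φ => ?_
  induction φ <;> simp [Formula.check, Formula.Positive, *]

theorem primrecPred_restricted : PrimrecPred Formula.Restricted := by
  have hlen : Primrec fun p : ℕ × List ℕ => p.2.length := Primrec.list_length.comp Primrec.snd
  have hat : PrimrecRel fun (k : ℕ) (l : List ℕ) =>
      (∀ x ∈ l, x < 2) ∧ (l.length = 1 ∨ (l.length = 2 ∧ k = 0)) :=
    (((Primrec.nat_lt.comp Primrec.id (Primrec.const 2)).forall_mem_list).comp Primrec.snd).and <|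
      (Primrec.eq.comp hlen (Primrec.const 1)).or <|
      (Primrec.eq.comp hlen (Primrec.const 2)).and (Primrec.eq.comp Primrec.fst (Primrec.const 0))
  refine (Formula.primrecPred_check (b := True) (v := fun x => x < 2) hat
    (Primrec.nat_lt.comp Primrec.id (Primrec.const 2))).of_eq fun φ => ?_
  induction φ <;> simp only [Formula.check, Formula.Restricted, *]

/-! ### Hardness -/

theorem primrec_haltFormula (c : Turing.ToPartrec.Code) : Primrec (haltFormula c) := by
  have hletter : Primrec fun k : ℕ => (Property.singleton k).letter :=
    Primrec.nat_add.comp (Primrec.nat_mul.comp (Primrec.const 6) Primrec.id) (Primrec.const 16)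
  have hsingle (x : ℕ) : Primrec fun k : ℕ => Formula.atom (Property.singleton k).letter [x] :=
    primrec_atom hletter (Primrec.const _)
  have hrule : Primrec fun k => (singletonSuccRule k).toFormula :=
    primrec_all (Primrec.const 0) <| primrec_all (Primrec.const 1) <| primrec_imp
      (primrec_and (hsingle 0) (Primrec.const _))
      (primrec_or (primrec_and ((hsingle 1).comp Primrec.succ) (Primrec.const _))
        (Primrec.const _))
  have hinput : Primrec inputFormula := by
    refine (Primrec.nat_rec₁ singletonZeroRule.toFormula
      (f := fun k φ => φ.and (singletonSuccRule k).toFormula)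
      (primrec_and Primrec.snd (hrule.comp Primrec.fst)).to₂).of_eq fun n => ?_
    induction n with
    | zero => rfl
    | succ n ih => rw [inputFormula, ← ih]
  exact primrec_imp (Primrec.const _) <| primrec_imp hinput <| primrec_imp
    (primrec_all (Primrec.const 0) (primrec_imp (primrec_and (hsingle 0) (Primrec.const _))
      (Primrec.const _))) (Primrec.const _)

theorem exists_code_dom_iff {q : ℕ → Prop} (hq : REPred q) :
    ∃ c : Turing.ToPartrec.Code, ∀ n, (c.eval [n]).Dom ↔ q n := by
  have h : Partrec fun n : ℕ => (Part.assert (q n) fun _ => Part.some ()).map fun _ => 0 :=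
    hq.map (Computable.const 0).to₂
  obtain ⟨c, hc⟩ := Turing.ToPartrec.Code.exists_code (Nat.Partrec'.part_iff₁.2 h)
  refine ⟨c, fun n => ?_⟩
  have := hc (n ::ᵥ List.Vector.nil)
  rw [show c.eval [n] = _ from this]
  simp [Part.assert]

/-- Every recursively enumerable set is reducible to a set of formulas that contains the positive
restricted formulas of `QInt` and is contained in `QLC.cd`. -/
theorem manyOneReducible_of_between {L : Set Formula}
    (h₁ : ∀ φ ∈ QInt, φ.Positive → φ.Restricted → φ ∈ L) (h₂ : L ⊆ QLCcd)
    {q : ℕ → Prop} (hq : REPred q) : ManyOneReducible q fun φ => φ ∈ L := by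
  obtain ⟨c, hc⟩ := exists_code_dom_iff hq
  refine ⟨haltFormula c, (primrec_haltFormula c).to_comp, fun n => ?_⟩
  rw [← hc n]
  have h := haltFormula_positive_restricted c n
  refine ⟨fun hn => h₁ _ (haltFormula_mem_QInt hn) h.1 h.2, fun hL => ?_⟩
  by_contra hn
  exact haltFormula_notMem_QLCcd hn (h₂ hL)

/-! ### Recursive enumerability -/

theorem rePred_exists {α : Type*} [Primcodable α] {p : α → ℕ → Prop} (hp : PrimrecRel p) :
    REPred fun a => ∃ n, p a n := by
  classical
  have h : Partrec fun a => Nat.rfind fun n => Part.some (decide (p a n)) :=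
    Partrec.rfind hp.decide.to_comp.partrec₂
  refine h.dom_re.of_eq fun a => Nat.rfind_dom.trans ?_
  simp

end IntPred

namespace IntPred

/-! ### Coherent valuations -/

/-- The assignment given by an association list; a variable `x` that is not listed is sent to
the individual `2 * x`. -/
def assign (e : List (ℕ × ℕ)) (x : ℕ) : ℕ := (e.lookup x).getD (2 * x)

theorem assign_cons (x d : ℕ) (e : List (ℕ × ℕ)) :
    assign ((x, d) :: e) = Function.update (assign e) x d := by
  funext y
  by_cases h : y = x
  · simp [assign, h]
  · have : (y == x) = false := by simpa using h
    simp [assign, List.lookup, h, this]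

/-- The atomic statements about a countable Kripke model: `forces w e φ` (truth of `φ` at the world
`w` under the assignment `e`), `ind w d` (existence of the individual `d` at `w`), and
`holds w k l` (membership of `l` in the interpretation at `w` of the letter `k`). -/
abbrev Bit : Type := (ℕ × List (ℕ × ℕ) × Formula) ⊕ (ℕ × ℕ) ⊕ (ℕ × ℕ × List ℕ)

namespace Bit

/-- The statement that `φ` is true at `w` under `e`. -/
abbrev forces (w : ℕ) (e : List (ℕ × ℕ)) (φ : Formula) : Bit := Sum.inl (w, e, φ)

/-- The statement that `d` exists at `w`. -/
abbrev ind (w d : ℕ) : Bit := Sum.inr (Sum.inl (w, d))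

/-- The statement that the letter `k` applies to `l` at `w`. -/
abbrev holds (w k : ℕ) (l : List ℕ) : Bit := Sum.inr (Sum.inr (w, k, l))

end Bit

open Bit

/-- The world above `w` that witnesses the failure of the implication or universal formula `φ` at `w`
under `e`. All worlds other than the root `0` have this form. -/
noncomputable def skolemWorld (w : ℕ) (e : List (ℕ × ℕ)) (φ : Formula) : ℕ :=
  Encodable.encode (w, e, φ) + 1

/-- The individual that witnesses the truth of the existential formula, or the failure of the
universal formula `φ` at `w` under `e`. These individuals are odd; the even ones are the initial
values of the variables. -/
noncomputable def skolemInd (w : ℕ) (e : List (ℕ × ℕ)) (φ : Formula) : ℕ :=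
  2 * Encodable.encode (w, e, φ) + 1

/-- The conditions on a valuation of the statements that make it describe a Kripke model whose worlds
form the tree in which the worlds `skolemWorld w e φ` are the successors of `w`. -/
structure Coherent (X : Bit → Prop) : Prop where
  root (x) : X (ind 0 (2 * x))
  ind_mono (w e) (φ : Formula) (d) : X (ind w d) → X (ind (skolemWorld w e φ) d)
  forces_mono (w e) (φ : Formula) (e' ψ) : X (forces w e' ψ) → X (forces (skolemWorld w e φ) e' ψ)
  holds_mono (w e) (φ : Formula) (k l) : X (holds w k l) → X (holds (skolemWorld w e φ) k l)
  bot (w e) : ¬ X (forces w e .bot)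
  atom (w e k l) : X (forces w e (.atom k l)) ↔ X (holds w k (l.map (assign e)))
  and (w e) (φ ψ : Formula) : X (forces w e (φ.and ψ)) ↔ X (forces w e φ) ∧ X (forces w e ψ)
  or (w e) (φ ψ : Formula) : X (forces w e (φ.or ψ)) ↔ X (forces w e φ) ∨ X (forces w e ψ)
  imp (w e) (φ ψ : Formula) : X (forces w e (φ.imp ψ)) → X (forces w e φ) → X (forces w e ψ)
  imp_skolem_left (w e) (φ ψ : Formula) :
    X (forces w e (φ.imp ψ)) ∨ X (forces (skolemWorld w e (φ.imp ψ)) e φ)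
  imp_skolem_right (w e) (φ ψ : Formula) :
    X (forces (skolemWorld w e (φ.imp ψ)) e ψ) → X (forces w e (φ.imp ψ))
  all (w e x) (φ : Formula) (d) :
    X (forces w e (φ.all x)) → X (ind w d) → X (forces w ((x, d) :: e) φ)
  all_skolem_ind (w e x) (φ : Formula) :
    X (forces w e (φ.all x)) ∨ X (ind (skolemWorld w e (φ.all x)) (skolemInd w e (φ.all x)))
  all_skolem (w e x) (φ : Formula) :
    X (forces (skolemWorld w e (φ.all x)) ((x, skolemInd w e (φ.all x)) :: e) φ) →
      X (forces w e (φ.all x))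
  ex (w e x) (φ : Formula) (d) :
    X (forces w ((x, d) :: e) φ) → X (ind w d) → X (forces w e (φ.ex x))
  ex_skolem_ind (w e x) (φ : Formula) : X (forces w e (φ.ex x)) → X (ind w (skolemInd w e (φ.ex x)))
  ex_skolem (w e x) (φ : Formula) :
    X (forces w e (φ.ex x)) → X (forces w ((x, skolemInd w e (φ.ex x)) :: e) φ)

/-- The type of the parameters (worlds, association lists, formulas, variables or letters,
individuals, lists of individuals) on which the coherence conditions depend. -/
abbrev Param : Type :=
  ℕ × List (ℕ × ℕ) × List (ℕ × ℕ) × Formula × Formula × ℕ × ℕ × List ℕ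

/-- The coherence conditions for given parameters. A pair `(Γ, Δ)` of lists expresses
that if all statements in `Γ` hold then so does one in `Δ`. -/
noncomputable def sequents : Param → List (List Bit × List Bit)
  | (w, e, e', φ, ψ, x, d, l) =>
    [([], [ind 0 (2 * x)]),
     ([ind w d], [ind (skolemWorld w e φ) d]),
     ([forces w e' ψ], [forces (skolemWorld w e φ) e' ψ]),
     ([holds w x l], [holds (skolemWorld w e φ) x l]),
     ([forces w e .bot], []),
     ([forces w e (.atom x l)], [holds w x (l.map (assign e))]),
     ([holds w x (l.map (assign e))], [forces w e (.atom x l)]),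
     ([forces w e (φ.and ψ)], [forces w e φ]),
     ([forces w e (φ.and ψ)], [forces w e ψ]),
     ([forces w e φ, forces w e ψ], [forces w e (φ.and ψ)]),
     ([forces w e (φ.or ψ)], [forces w e φ, forces w e ψ]),
     ([forces w e φ], [forces w e (φ.or ψ)]),
     ([forces w e ψ], [forces w e (φ.or ψ)]),
     ([forces w e (φ.imp ψ), forces w e φ], [forces w e ψ]),
     ([], [forces w e (φ.imp ψ), forces (skolemWorld w e (φ.imp ψ)) e φ]),
     ([forces (skolemWorld w e (φ.imp ψ)) e ψ], [forces w e (φ.imp ψ)]),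
     ([forces w e (φ.all x), ind w d], [forces w ((x, d) :: e) φ]),
     ([], [forces w e (φ.all x), ind (skolemWorld w e (φ.all x)) (skolemInd w e (φ.all x))]),
     ([forces (skolemWorld w e (φ.all x)) ((x, skolemInd w e (φ.all x)) :: e) φ],
      [forces w e (φ.all x)]),
     ([forces w ((x, d) :: e) φ, ind w d], [forces w e (φ.ex x)]),
     ([forces w e (φ.ex x)], [ind w (skolemInd w e (φ.ex x))]),
     ([forces w e (φ.ex x)], [forces w ((x, skolemInd w e (φ.ex x)) :: e) φ])]

/-- Truth of a sequent under a valuation. -/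
def SequentHolds (X : Bit → Prop) (s : List Bit × List Bit) : Prop :=
  (∀ β ∈ s.1, X β) → ∃ β ∈ s.2, X β

theorem coherent_iff {X : Bit → Prop} :
    Coherent X ↔ ∀ p, ∀ s ∈ sequents p, SequentHolds X s := by
  constructor
  · rintro h ⟨w, e, e', φ, ψ, x, d, l⟩
    simp only [sequents, List.forall_mem_cons, SequentHolds, List.not_mem_nil, IsEmpty.forall_iff,
      implies_true, and_true, List.exists_mem_cons_iff, false_and, exists_false, or_false,
      forall_const, and_imp, imp_false]
    exact ⟨h.root x, h.ind_mono w e φ d, h.forces_mono w e φ e' ψ, h.holds_mono w e φ x l, h.bot w e,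
      (h.atom w e x l).1, (h.atom w e x l).2, fun hx => ((h.and w e φ ψ).1 hx).1,
      fun hx => ((h.and w e φ ψ).1 hx).2, fun h₁ h₂ => (h.and w e φ ψ).2 ⟨h₁, h₂⟩,
      (h.or w e φ ψ).1, fun hx => (h.or w e φ ψ).2 (Or.inl hx),
      fun hx => (h.or w e φ ψ).2 (Or.inr hx), h.imp w e φ ψ, h.imp_skolem_left w e φ ψ,
      h.imp_skolem_right w e φ ψ, h.all w e x φ d, h.all_skolem_ind w e x φ, h.all_skolem w e x φ,
      h.ex w e x φ d, h.ex_skolem_ind w e x φ, h.ex_skolem w e x φ⟩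
  · intro h
    have key := fun w e e' φ ψ x d l => h (w, e, e', φ, ψ, x, d, l)
    simp only [sequents, List.forall_mem_cons, SequentHolds, List.not_mem_nil, IsEmpty.forall_iff,
      implies_true, and_true, List.exists_mem_cons_iff, false_and, exists_false, or_false,
      forall_const, and_imp, imp_false] at key
    simp only [forall_and] at key
    obtain ⟨h₁, h₂, h₃, h₄, h₅, h₆, h₇, h₈, h₉, h₁₀, h₁₁, h₁₂, h₁₃, h₁₄, h₁₅, h₁₆, h₁₇, h₁₈, h₁₉,
      h₂₀, h₂₁, h₂₂⟩ := key
    exact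
      { root := fun x => h₁ 0 [] [] .bot .bot x 0 []
        ind_mono := fun w e φ d => h₂ w e [] φ .bot 0 d []
        forces_mono := fun w e φ e' ψ => h₃ w e e' φ ψ 0 0 []
        holds_mono := fun w e φ k l => h₄ w e [] φ .bot k 0 l
        bot := fun w e => h₅ w e [] .bot .bot 0 0 []
        atom := fun w e k l => ⟨h₆ w e [] .bot .bot k 0 l, h₇ w e [] .bot .bot k 0 l⟩
        and := fun w e φ ψ => ⟨fun hx => ⟨h₈ w e [] φ ψ 0 0 [] hx, h₉ w e [] φ ψ 0 0 [] hx⟩,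
          fun hx => h₁₀ w e [] φ ψ 0 0 [] hx.1 hx.2⟩
        or := fun w e φ ψ => ⟨h₁₁ w e [] φ ψ 0 0 [],
          fun hx => hx.elim (h₁₂ w e [] φ ψ 0 0 []) (h₁₃ w e [] φ ψ 0 0 [])⟩
        imp := fun w e φ ψ => h₁₄ w e [] φ ψ 0 0 []
        imp_skolem_left := fun w e φ ψ => h₁₅ w e [] φ ψ 0 0 []
        imp_skolem_right := fun w e φ ψ => h₁₆ w e [] φ ψ 0 0 []
        all := fun w e x φ d => h₁₇ w e [] φ .bot x d []
        all_skolem_ind := fun w e x φ => h₁₈ w e [] φ .bot x 0 []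
        all_skolem := fun w e x φ => h₁₉ w e [] φ .bot x 0 []
        ex := fun w e x φ d => h₂₀ w e [] φ .bot x d []
        ex_skolem_ind := fun w e x φ => h₂₁ w e [] φ .bot x 0 []
        ex_skolem := fun w e x φ => h₂₂ w e [] φ .bot x 0 [] }

/-! ### From coherent valuations to Kripke models -/

/-- `v` is an immediate successor of `w` in the tree of worlds. -/
def Child (w v : ℕ) : Prop := ∃ e φ, v = skolemWorld w e φ

theorem Child.lt {w v : ℕ} (h : Child w v) : w < v := by
  obtain ⟨e, φ, rfl⟩ := h
  exact Nat.lt_succ_of_le (Nat.left_le_pair _ _)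

theorem exists_child {v : ℕ} (hv : v ≠ 0) : ∃ w, Child w v := by
  obtain ⟨n, rfl⟩ := Nat.exists_eq_succ_of_ne_zero hv
  obtain ⟨⟨w, e, φ⟩, h⟩ : ∃ t : ℕ × List (ℕ × ℕ) × Formula, Encodable.encode t = n :=
    ⟨Denumerable.ofNat _ n, Denumerable.encode_ofNat n⟩
  exact ⟨w, e, φ, by rw [skolemWorld, h]⟩

namespace Coherent

variable {X : Bit → Prop}

theorem mono_of_child (h : Coherent X) {w v : ℕ} (hwv : Relation.ReflTransGen Child w v) :
    (∀ d, X (ind w d) → X (ind v d)) ∧ (∀ e φ, X (forces w e φ) → X (forces v e φ)) ∧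
      ∀ k l, X (holds w k l) → X (holds v k l) := by
  induction hwv with
  | refl => exact ⟨fun _ => id, fun _ _ => id, fun _ _ => id⟩
  | tail _ hc ih =>
    obtain ⟨e, φ, rfl⟩ := hc
    exact ⟨fun d hd => h.ind_mono _ _ _ _ (ih.1 d hd),
      fun e φ hd => h.forces_mono _ _ _ _ _ (ih.2.1 e φ hd),
      fun k l hd => h.holds_mono _ _ _ _ _ (ih.2.2 k l hd)⟩

theorem exists_ind (h : Coherent X) (w : ℕ) : ∃ d, X (ind w d) := by
  induction w using Nat.strong_induction_on with
  | _ w ih =>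
    by_cases hw : w = 0
    · exact ⟨2 * 0, hw ▸ h.root 0⟩
    · obtain ⟨u, hu⟩ := exists_child hw
      obtain ⟨d, hd⟩ := ih u hu.lt
      exact ⟨d, (h.mono_of_child (.single hu)).1 d hd⟩

theorem le_of_reflTransGen {w v : ℕ} (hwv : Relation.ReflTransGen Child w v) : w ≤ v := by
  induction hwv with
  | refl => exact le_rfl
  | tail _ hc ih => exact ih.trans hc.lt.le

/-- The Kripke model described by a coherent valuation. -/
abbrev model (h : Coherent X) : KripkeModel where
  World := ℕ
  world_nonempty := ⟨0⟩
  R := Relation.ReflTransGen Child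
  refl _ := .refl
  trans _ _ _ := .trans
  antisymm _ _ h₁ h₂ := le_antisymm (le_of_reflTransGen h₁) (le_of_reflTransGen h₂)
  Ind := ℕ
  dom w := {d | X (ind w d)}
  dom_nonempty := h.exists_ind
  dom_expanding _ _ hw d := (h.mono_of_child hw).1 d
  interp w k := {l | X (holds w k l) ∧ ∀ d ∈ l, X (ind w d)}
  interp_dom _ _ _ hl := hl.2
  interp_hereditary _ _ hw k l hl :=
    ⟨(h.mono_of_child hw).2.2 k l hl.1, fun d hd => (h.mono_of_child hw).1 d (hl.2 d hd)⟩

/-- In the model of a coherent valuation truth is as the valuation says: an induction on formulas, in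
which the Skolem worlds and individuals provide the counterexamples and witnesses. -/
theorem forces_iff (h : Coherent X) (φ : Formula) (w : ℕ) (e : List (ℕ × ℕ))
    (he : ∀ x, X (ind w (assign e x))) :
    h.model.Forces w (assign e) φ ↔ X (forces w e φ) := by
  have hcons : ∀ {v : ℕ} {f : List (ℕ × ℕ)} {x d : ℕ}, (∀ y, X (ind v (assign f y))) →
      X (ind v d) → ∀ y, X (ind v (assign ((x, d) :: f) y)) := fun {v f x d} hf hd y => by
    by_cases hy : y = x
    · simpa [assign_cons, hy] using hd
    · simpa [assign_cons, hy] using hf y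
  have hup : ∀ {v : ℕ}, Relation.ReflTransGen Child w v → ∀ x, X (ind v (assign e x)) :=
    fun hv x => (h.mono_of_child hv).1 _ (he x)
  have hsk : ∀ φ, Relation.ReflTransGen Child w (skolemWorld w e φ) :=
    fun φ => .single ⟨e, φ, rfl⟩
  induction φ generalizing w e with
  | bot => exact iff_of_false id (h.bot w e)
  | atom k l =>
    rw [h.atom]
    refine ⟨fun hl => hl.1, fun hl => ⟨hl, fun d hd => ?_⟩⟩
    obtain ⟨x, _, rfl⟩ := List.mem_map.1 hd
    exact he x
  | and φ ψ ihφ ihψ =>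
    exact (and_congr (ihφ w e he hup hsk) (ihψ w e he hup hsk)).trans (h.and w e φ ψ).symm
  | or φ ψ ihφ ihψ =>
    exact (or_congr (ihφ w e he hup hsk) (ihψ w e he hup hsk)).trans (h.or w e φ ψ).symm
  | imp φ ψ ihφ ihψ =>
    have up : ∀ {v u : ℕ}, Relation.ReflTransGen Child w v → Relation.ReflTransGen Child v u →
      ∀ x, X (ind u (assign e x)) := fun h₁ h₂ => hup (h₁.trans h₂)
    have ihφ := fun v hv => ihφ v e (hup hv) (up hv) fun φ => .single ⟨e, φ, rfl⟩
    have ihψ := fun v hv => ihψ v e (hup hv) (up hv) fun φ => .single ⟨e, φ, rfl⟩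
    constructor
    · intro hf
      rcases h.imp_skolem_left w e φ ψ with h' | h'
      · exact h'
      · exact h.imp_skolem_right w e φ ψ ((ihψ _ (hsk _)).1
          (hf _ (hsk _) ((ihφ _ (hsk _)).2 h')))
    · intro hX v hv hφ
      exact (ihψ v hv).2 (h.imp v e φ ψ ((h.mono_of_child hv).2.1 _ _ hX) ((ihφ v hv).1 hφ))
  | all x φ ih =>
    have ih : ∀ v, Relation.ReflTransGen Child w v → ∀ d, X (ind v d) →
        (h.model.Forces v (Function.update (assign e) x d) φ ↔ X (forces v ((x, d) :: e) φ)) := by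
      intro v hv d hd
      rw [← assign_cons]
      have hd' := hcons (x := x) (hup hv) hd
      exact ih v _ hd' (fun hu y => (h.mono_of_child hu).1 _ (hd' y)) fun φ => .single ⟨_, φ, rfl⟩
    constructor
    · intro hf
      rcases h.all_skolem_ind w e x φ with h' | h'
      · exact h'
      · exact h.all_skolem w e x φ ((ih _ (hsk _) _ h').1 (hf _ (hsk _) _ h'))
    · intro hX v hv d hd
      exact (ih v hv d hd).2 (h.all v e x φ d ((h.mono_of_child hv).2.1 _ _ hX) hd)
  | ex x φ ih =>
    have ih : ∀ d, X (ind w d) →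
        (h.model.Forces w (Function.update (assign e) x d) φ ↔ X (forces w ((x, d) :: e) φ)) := by
      intro d hd
      rw [← assign_cons]
      have hd' := hcons (x := x) he hd
      exact ih w _ hd' (fun hu y => (h.mono_of_child hu).1 _ (hd' y)) fun φ => .single ⟨_, φ, rfl⟩
    constructor
    · rintro ⟨d, hd, hf⟩
      exact h.ex w e x φ d ((ih d hd).1 hf) hd
    · intro hX
      have hd := h.ex_skolem_ind w e x φ hX
      exact ⟨_, hd, (ih _ hd).2 (h.ex_skolem w e x φ hX)⟩

end Coherent

/-! ### From Kripke models to coherent valuations -/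

/-- Strong recursion along the natural numbers, for a step function that uses only previous
values. -/
theorem exists_strongRec {α : Type*} [Nonempty α] (step : (ℕ → α) → ℕ → α)
    (hstep : ∀ s s' n, (∀ k < n, s k = s' k) → step s n = step s' n) :
    ∃ s : ℕ → α, ∀ n, s n = step s n := by
  classical
  let F : (n : ℕ) → ((k : ℕ) → k < n → α) → α := fun n ih =>
    step (fun k => if h : k < n then ih k h else Classical.arbitrary α) n
  refine ⟨wellFounded_lt.fix F, fun n => ?_⟩
  rw [WellFounded.fix_eq]
  exact hstep _ _ n fun k hk => dif_pos hk

/-- The world `v` above `w` and the individual `d` witness that `φ` fails at `w`, if `φ` is an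
implication or a universal formula, or that `φ` is true at `w`, if it is existential. -/
def KripkeModel.Witness (M : KripkeModel) (w : M.World) (g : ℕ → M.Ind) (φ : Formula)
    (v : M.World) (d : M.Ind) : Prop :=
  M.R w v ∧ match φ with
    | .imp φ ψ => ¬ M.Forces w g (φ.imp ψ) → M.Forces v g φ ∧ ¬ M.Forces v g ψ
    | .all x φ => ¬ M.Forces w g (φ.all x) → d ∈ M.dom v ∧ ¬ M.Forces v (Function.update g x d) φ
    | .ex x φ => M.Forces w g (φ.ex x) → d ∈ M.dom w ∧ M.Forces w (Function.update g x d) φ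
    | _ => True

theorem KripkeModel.exists_witness (M : KripkeModel) (w : M.World) (g : ℕ → M.Ind) (φ : Formula) :
    ∃ p : M.World × M.Ind, M.Witness w g φ p.1 p.2 := by
  cases φ with
  | bot | atom | and | or => exact ⟨(w, g 0), M.refl w, trivial⟩
  | imp φ ψ =>
    by_cases h : M.Forces w g (φ.imp ψ)
    · exact ⟨(w, g 0), M.refl w, fun h' => (h' h).elim⟩
    · have h' := h
      simp only [Forces, not_forall] at h'
      obtain ⟨v, hv, hφ, hψ⟩ := h'
      exact ⟨(v, g 0), hv, fun _ => ⟨hφ, hψ⟩⟩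
  | all x φ =>
    by_cases h : M.Forces w g (φ.all x)
    · exact ⟨(w, g 0), M.refl w, fun h' => (h' h).elim⟩
    · have h' := h
      simp only [Forces, not_forall] at h'
      obtain ⟨v, hv, d, hd, hφ⟩ := h'
      exact ⟨(v, d), hv, fun _ => ⟨hd, hφ⟩⟩
  | ex x φ =>
    by_cases h : M.Forces w g (φ.ex x)
    · obtain ⟨d, hd, hφ⟩ := h
      exact ⟨(w, d), M.refl w, fun _ => ⟨hd, hφ⟩⟩
    · exact ⟨(w, g 0), M.refl w, fun h' => (h h').elim⟩

theorem le_encode_of_lookup {e : List (ℕ × ℕ)} {x d : ℕ} (h : e.lookup x = some d) :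
    d ≤ Encodable.encode e := by
  induction e with
  | nil => simp at h
  | cons p e ih =>
    have h₁ : Encodable.encode (p :: e) =
      Nat.succ (Nat.pair (Nat.pair p.1 p.2) (Encodable.encode e)) := rfl
    have h₂ := Nat.left_le_pair (Nat.pair p.1 p.2) (Encodable.encode e)
    have h₃ := Nat.right_le_pair (Nat.pair p.1 p.2) (Encodable.encode e)
    have h₄ := Nat.right_le_pair p.1 p.2
    rw [List.lookup] at h
    split at h
    · obtain rfl := Option.some.inj h
      omega
    · have := ih h
      omega

/-- The worlds and individuals of the tree of Skolem worlds can be interpreted in a Kripke model. -/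
theorem KripkeModel.exists_skolem (M : KripkeModel) (w₀ : M.World) (g₀ : ℕ → M.Ind) :
    ∃ (W : ℕ → M.World) (D : ℕ → M.Ind), W 0 = w₀ ∧ (∀ x, D (2 * x) = g₀ x) ∧
      ∀ w e φ, M.Witness (W w) (D ∘ assign e) φ (W (skolemWorld w e φ)) (D (skolemInd w e φ)) := by
  choose p hp using M.exists_witness
  let W : (ℕ → M.World × M.Ind) → ℕ → M.World := fun s n => Nat.casesOn n w₀ fun k => (s k).1
  let D : (ℕ → M.World × M.Ind) → ℕ → M.Ind := fun s d =>
    if d % 2 = 0 then g₀ (d / 2) else (s (d / 2)).2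
  let step : (ℕ → M.World × M.Ind) → ℕ → M.World × M.Ind := fun s n =>
    let t := Denumerable.ofNat (ℕ × List (ℕ × ℕ) × Formula) n
    p (W s t.1) (D s ∘ assign t.2.1) t.2.2
  have : Nonempty (M.World × M.Ind) := ⟨(w₀, g₀ 0)⟩
  obtain ⟨s, hs⟩ := exists_strongRec step fun s s' n hn => by
    obtain ⟨⟨w, e, φ⟩, rfl⟩ : ∃ t : ℕ × List (ℕ × ℕ) × Formula, Encodable.encode t = n :=
      ⟨Denumerable.ofNat _ n, Denumerable.encode_ofNat n⟩
    have h₁ : w ≤ Encodable.encode (w, e, φ) := Nat.left_le_pair _ _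
    have h₂ : Encodable.encode e ≤ Encodable.encode (w, e, φ) :=
      (Nat.left_le_pair _ _).trans (Nat.right_le_pair _ _)
    have hW : W s w = W s' w := by
      cases w with
      | zero => rfl
      | succ w => exact congrArg Prod.fst (hn w (by omega))
    have hD : D s ∘ assign e = D s' ∘ assign e := by
      funext x
      simp only [D, Function.comp]
      cases hx : e.lookup x with
      | none => simp [assign, hx]
      | some d =>
        have := le_encode_of_lookup hx
        simp only [assign, hx, Option.getD_some]
        split_ifs with hd
        · rfl
        · rw [hn (d / 2) (by omega)]
    simp only [step, Denumerable.ofNat_encode, hW, hD]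
  refine ⟨W s, D s, rfl, fun x => by simp [D], fun w e φ => ?_⟩
  have hs' := hs (Encodable.encode (w, e, φ))
  simp only [step, Denumerable.ofNat_encode] at hs'
  have hW : W s (skolemWorld w e φ) = (s (Encodable.encode (w, e, φ))).1 := rfl
  have hD : D s (skolemInd w e φ) = (s (Encodable.encode (w, e, φ))).2 := by
    have h₁ : (2 * Encodable.encode (w, e, φ) + 1) % 2 = 1 := by omega
    have h₂ : (2 * Encodable.encode (w, e, φ) + 1) / 2 = Encodable.encode (w, e, φ) := by omega
    simp only [D, skolemInd, h₁, h₂, one_ne_zero, if_false]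
  rw [hW, hD, hs']
  exact hp _ _ _

/-- Truth in a Kripke model, read along an interpretation of the Skolem worlds and individuals, is a
coherent valuation. -/
theorem KripkeModel.exists_coherent (M : KripkeModel) (w₀ : M.World) (g₀ : ℕ → M.Ind)
    (hg₀ : ∀ x, g₀ x ∈ M.dom w₀) :
    ∃ X, Coherent X ∧ ∀ φ, X (forces 0 [] φ) ↔ M.Forces w₀ g₀ φ := by
  obtain ⟨W, D, hW, hD, hwit⟩ := M.exists_skolem w₀ g₀
  have hcons : ∀ x d e, D ∘ assign ((x, d) :: e) = Function.update (D ∘ assign e) x (D d) :=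
    fun x d e => by rw [assign_cons, Function.comp_update]
  let X : Bit → Prop
    | .inl (w, e, φ) => M.Forces (W w) (D ∘ assign e) φ
    | .inr (.inl (w, d)) => D d ∈ M.dom (W w)
    | .inr (.inr (w, k, l)) => l.map D ∈ M.interp (W w) k
  refine ⟨X, ?_, fun φ => ?_⟩
  · constructor
    · intro x
      show D (2 * x) ∈ M.dom (W 0)
      rw [hD, hW]
      exact hg₀ x
    · exact fun w e φ d hd => M.dom_expanding _ _ (hwit w e φ).1 hd
    · exact fun w e φ e' ψ hψ => hψ.mono (hwit w e φ).1
    · exact fun w e φ k l hl => M.interp_hereditary _ _ (hwit w e φ).1 k hl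
    · exact fun w e hb => hb
    · intro w e k l
      show l.map (D ∘ assign e) ∈ _ ↔ (l.map (assign e)).map D ∈ _
      rw [List.map_map]
    · exact fun w e φ ψ => Iff.rfl
    · exact fun w e φ ψ => Iff.rfl
    · exact fun w e φ ψ h hφ => h _ (M.refl _) hφ
    · exact fun w e φ ψ => or_iff_not_imp_left.2 fun h => ((hwit w e (φ.imp ψ)).2 h).1
    · exact fun w e φ ψ h => by_contra fun h' => ((hwit w e (φ.imp ψ)).2 h').2 h
    · intro w e x φ d h hd
      show M.Forces _ (D ∘ assign _) _
      rw [hcons]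
      exact h _ (M.refl _) _ hd
    · exact fun w e x φ => or_iff_not_imp_left.2 fun h => ((hwit w e (φ.all x)).2 h).1
    · intro w e x φ (h : M.Forces _ (D ∘ assign _) _)
      rw [hcons] at h
      exact by_contra fun h' => ((hwit w e (φ.all x)).2 h').2 h
    · intro w e x φ d (h : M.Forces _ (D ∘ assign _) _) hd
      rw [hcons] at h
      exact ⟨_, hd, h⟩
    · exact fun w e x φ h => ((hwit w e (φ.ex x)).2 h).1
    · intro w e x φ h
      show M.Forces _ (D ∘ assign _) _
      rw [hcons]
      exact ((hwit w e (φ.ex x)).2 h).2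
  · show M.Forces (W 0) (D ∘ assign []) φ ↔ _
    rw [hW, show D ∘ assign [] = g₀ from funext fun x => hD x]

/-- Validity is truth at the root under all coherent valuations. -/
theorem mem_QInt_iff_coherent {φ : Formula} :
    φ ∈ QInt ↔ ∀ X, Coherent X → X (forces 0 [] φ) := by
  rw [mem_QInt_iff]
  constructor
  · intro hφ X h
    exact (h.forces_iff φ 0 [] h.root).1 (hφ h.model (0 : ℕ) (assign []) h.root)
  · intro hφ M w g hg
    obtain ⟨X, hX, h⟩ := M.exists_coherent w g hg
    exact (h φ).1 (hφ X hX)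

end IntPred

namespace IntPred

open Formula (allBelow chain)
open Bit

/-! ### Compactness -/

/-- The bit at the code of the statement `β` in the binary expansion of `m` is `b`. Only the `N`
lowest bits of `m` are read. -/
def BitIs (N m : ℕ) (b : Bool) (β : Bit) : Prop :=
  Encodable.encode β < N ∧ m.testBit (Encodable.encode β) = b

/-- The `N` lowest bits of `m` make the sequent `s` false. -/
def Refutes (N m : ℕ) (s : List Bit × List Bit) : Prop :=
  (∀ β ∈ s.1, BitIs N m true β) ∧ ∀ β ∈ s.2, BitIs N m false β

/-- Every assignment of truth values to the statements with codes below `N` makes `φ` true at the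
root or refutes one of the coherence conditions for the first `N` parameters. -/
def Certificate (φ : Formula) (N : ℕ) : Prop :=
  ∀ m < 2 ^ N, BitIs N m true (forces 0 [] φ) ∨
    ∃ n < N, ∃ s ∈ sequents (Denumerable.ofNat Param n), Refutes N m s

/-- A coherent valuation refutes no coherence condition, so a certificate makes `φ` true at the root
under it: apply the certificate to the number whose bits are the truth values. -/
theorem Certificate.apply_root {φ : Formula} {N : ℕ} (h : Certificate φ N) {X : Bit → Prop}
    (hX : Coherent X) : X (forces 0 [] φ) := by
  classical
  let f : Fin N → Bool := fun i => ∃ β, Encodable.encode β = i.1 ∧ X β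
  have hf : ∀ {b β}, BitIs N (Nat.ofBits f) b β → (X β ↔ b = true) := by
    rintro b β ⟨hβ, rfl⟩
    rw [Nat.testBit_ofBits_lt f _ hβ, decide_eq_true_iff]
    refine ⟨fun h => ⟨β, rfl, h⟩, ?_⟩
    rintro ⟨γ, hγ, h⟩
    exact Encodable.encode_injective hγ ▸ h
  rcases h _ (Nat.ofBits_lt_two_pow f) with h | ⟨n, -, s, hs, hΓ, hΔ⟩
  · exact (hf h).2 rfl
  · obtain ⟨β, hβ, hXβ⟩ := coherent_iff.1 hX _ s hs fun β hβ => (hf (hΓ β hβ)).2 rfl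
    exact absurd ((hf (hΔ β hβ)).1 hXβ) Bool.false_ne_true

theorem isClosed_sequentHolds (s : List Bit × List Bit) :
    IsClosed {X : Bit → Bool | SequentHolds (fun β => X β = true) s} := by
  have h : ∀ β, IsClopen {X : Bit → Bool | X β = true} := fun β =>
    (isClopen_discrete {true}).preimage (continuous_apply β)
  refine isClosed_imp ?_ ?_
  · have := s.1.finite_toSet.isOpen_biInter fun β _ => (h β).2
    simpa only [Set.ofPred_forall] using! this
  · have := s.2.finite_toSet.isClosed_biUnion fun β _ => (h β).1
    convert this using 1
    ext X
    simp

/-- By compactness of the space of valuations, finitely many coherence conditions suffice to make a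
valid formula true at the root. -/
theorem exists_certificate {φ : Formula} (h : ∀ X, Coherent X → X (forces 0 [] φ)) :
    ∃ N, Certificate φ N := by
  -- `K n` is the set of the valuations that satisfy the first `n` coherence conditions, but make `φ`
  -- false.
  let K : ℕ → Set (Bit → Bool) := fun n => {X | X (forces 0 [] φ) = false} ∩
    ⋂ k < n, ⋂ s ∈ sequents (Denumerable.ofNat Param k),
      {X | SequentHolds (fun β => X β = true) s}
  obtain ⟨n, hn⟩ : ∃ n, ¬ (K n).Nonempty := by
    by_contra! hK
    have hroot : IsClosed {X : Bit → Bool | X (forces 0 [] φ) = false} :=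
      isClosed_eq (continuous_apply (forces 0 [] φ)) continuous_const
    have hcl : ∀ n, IsClosed (K n) := fun n => hroot.inter <|
      isClosed_biInter fun k _ => isClosed_biInter fun s _ => isClosed_sequentHolds s
    obtain ⟨X, hX⟩ := IsCompact.nonempty_iInter_of_sequence_nonempty_isCompact_isClosed K
      (fun n => Set.inter_subset_inter_right _ <|
        Set.biInter_subset_biInter_left fun k hk => Nat.lt_succ_of_lt hk)
      hK (hcl 0).isCompact hcl
    rw [Set.mem_iInter] at hX
    have hcoh : Coherent fun β => X β = true := coherent_iff.2 fun p s hs => by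
      have := (hX (Encodable.encode p + 1)).2
      simp only [Set.mem_iInter] at this
      exact this (Encodable.encode p) (Nat.lt_succ_self _) s (by rwa [Denumerable.ofNat_encode])
    exact Bool.false_ne_true ((hX 0).1.symm.trans (h _ hcoh))
  -- `N` exceeds the codes of all statements that matter for `K n`.
  obtain ⟨N, hN⟩ : ∃ N, n ≤ N ∧ Encodable.encode (forces 0 [] φ) < N ∧
      ∀ k < n, ∀ s ∈ sequents (Denumerable.ofNat Param k), ∀ β,
        β ∈ s.1 ∨ β ∈ s.2 → Encodable.encode β < N := by
    let T : List Bit := (List.range n).flatMap fun k =>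
      (sequents (Denumerable.ofNat Param k)).flatMap fun s => s.1 ++ s.2
    refine ⟨n + Encodable.encode (forces 0 [] φ) + 1 + (T.map Encodable.encode).sum, by omega,
      by omega, fun k hk s hs β hβ => ?_⟩
    have : β ∈ T := List.mem_flatMap.2 ⟨k, List.mem_range.2 hk, List.mem_flatMap.2
      ⟨s, hs, List.mem_append.2 hβ⟩⟩
    have := List.le_sum_of_mem (List.mem_map_of_mem (f := Encodable.encode) this)
    omega
  refine ⟨N, fun m _ => ?_⟩
  by_contra! hm
  refine hn ⟨fun β => m.testBit (Encodable.encode β), ?_, ?_⟩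
  · exact Bool.eq_false_iff.2 fun h => hm.1 ⟨hN.2.1, h⟩
  · simp only [Set.mem_iInter]
    intro k hk s hs hΓ
    by_contra! hΔ
    exact hm.2 k (hk.trans_le hN.1) s hs ⟨fun β hβ => ⟨hN.2.2 k hk s hs β (Or.inl hβ), hΓ β hβ⟩,
      fun β hβ => ⟨hN.2.2 k hk s hs β (Or.inr hβ), Bool.eq_false_iff.2 (hΔ β hβ)⟩⟩

theorem mem_QInt_iff_exists_certificate {φ : Formula} : φ ∈ QInt ↔ ∃ N, Certificate φ N :=
  mem_QInt_iff_coherent.trans ⟨exists_certificate, fun ⟨_, h⟩ _ hX => h.apply_root hX⟩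

/-! ### Decidability of the certificates -/

section Primrec

variable {α : Type*} [Primcodable α]

theorem primrec_forces {w : α → ℕ} {e : α → List (ℕ × ℕ)} {φ : α → Formula} (hw : Primrec w)
    (he : Primrec e) (hφ : Primrec φ) : Primrec fun a => forces (w a) (e a) (φ a) :=
  Primrec.sumInl.comp (hw.pair (he.pair hφ))

theorem primrec_ind {w d : α → ℕ} (hw : Primrec w) (hd : Primrec d) :
    Primrec fun a => ind (w a) (d a) :=
  Primrec.sumInr.comp (Primrec.sumInl.comp (hw.pair hd))

theorem primrec_holds {w k : α → ℕ} {l : α → List ℕ} (hw : Primrec w) (hk : Primrec k)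
    (hl : Primrec l) : Primrec fun a => holds (w a) (k a) (l a) :=
  Primrec.sumInr.comp (Primrec.sumInr.comp (hw.pair (hk.pair hl)))

theorem primrec_skolemWorld {w : α → ℕ} {e : α → List (ℕ × ℕ)} {φ : α → Formula} (hw : Primrec w)
    (he : Primrec e) (hφ : Primrec φ) : Primrec fun a => skolemWorld (w a) (e a) (φ a) :=
  Primrec.succ.comp (Primrec.encode.comp (hw.pair (he.pair hφ)))

theorem primrec_skolemInd {w : α → ℕ} {e : α → List (ℕ × ℕ)} {φ : α → Formula} (hw : Primrec w)
    (he : Primrec e) (hφ : Primrec φ) : Primrec fun a => skolemInd (w a) (e a) (φ a) :=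
  Primrec.nat_double_succ.comp (Primrec.encode.comp (hw.pair (he.pair hφ)))

theorem primrec_assign : Primrec₂ assign :=
  Primrec.option_getD.comp (Primrec.listLookup.comp Primrec.snd Primrec.fst)
    (Primrec.nat_double.comp Primrec.snd)

theorem primrec_sequents : Primrec sequents := by
  have hw : Primrec fun p : Param => p.1 := Primrec.fst
  have t₁ : Primrec fun p : Param => p.2 := Primrec.snd
  have he : Primrec fun p : Param => p.2.1 := Primrec.fst.comp t₁
  have t₂ : Primrec fun p : Param => p.2.2 := Primrec.snd.comp t₁
  have he' : Primrec fun p : Param => p.2.2.1 := Primrec.fst.comp t₂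
  have t₃ : Primrec fun p : Param => p.2.2.2 := Primrec.snd.comp t₂
  have hφ : Primrec fun p : Param => p.2.2.2.1 := Primrec.fst.comp t₃
  have t₄ : Primrec fun p : Param => p.2.2.2.2 := Primrec.snd.comp t₃
  have hψ : Primrec fun p : Param => p.2.2.2.2.1 := Primrec.fst.comp t₄
  have t₅ : Primrec fun p : Param => p.2.2.2.2.2 := Primrec.snd.comp t₄
  have hx : Primrec fun p : Param => p.2.2.2.2.2.1 := Primrec.fst.comp t₅
  have t₆ : Primrec fun p : Param => p.2.2.2.2.2.2 := Primrec.snd.comp t₅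
  have hd : Primrec fun p : Param => p.2.2.2.2.2.2.1 := Primrec.fst.comp t₆
  have hl : Primrec fun p : Param => p.2.2.2.2.2.2.2 := Primrec.snd.comp t₆
  have nil : Primrec fun _ : Param => ([] : List Bit) := Primrec.const []
  have one {f : Param → Bit} (hf : Primrec f) : Primrec fun p => [f p] :=
    Primrec.list_cons.comp hf nil
  have two {f g : Param → Bit} (hf : Primrec f) (hg : Primrec g) : Primrec fun p => [f p, g p] :=
    Primrec.list_cons.comp hf (one hg)
  have cons {f g : Param → List Bit} {F : Param → List (List Bit × List Bit)} (hf : Primrec f)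
      (hg : Primrec g) (hF : Primrec F) : Primrec fun p => (f p, g p) :: F p :=
    Primrec.list_cons.comp (hf.pair hg) hF
  have ext {e : Param → List (ℕ × ℕ)} {d : Param → ℕ} (he : Primrec e) (hd : Primrec d) :
      Primrec fun p : Param => (p.2.2.2.2.2.1, d p) :: e p :=
    Primrec.list_cons.comp (hx.pair hd) he
  have hat := primrec_forces hw he (primrec_atom hx hl)
  have hmap := primrec_holds hw hx (Primrec.list_map hl (primrec_assign.comp (he.comp Primrec.fst)
    Primrec.snd).to₂)
  have fφ := primrec_forces hw he hφ
  have fψ := primrec_forces hw he hψ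
  have fand := primrec_forces hw he (primrec_and hφ hψ)
  have for' := primrec_forces hw he (primrec_or hφ hψ)
  have fimp := primrec_forces hw he (primrec_imp hφ hψ)
  have fall := primrec_forces hw he (primrec_all hx hφ)
  have fex := primrec_forces hw he (primrec_ex hx hφ)
  have wφ := primrec_skolemWorld hw he hφ
  have wimp := primrec_skolemWorld hw he (primrec_imp hφ hψ)
  have wall := primrec_skolemWorld hw he (primrec_all hx hφ)
  have iall := primrec_skolemInd hw he (primrec_all hx hφ)
  have iex := primrec_skolemInd hw he (primrec_ex hx hφ)
  have hind := primrec_ind hw hd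
  have fd := primrec_forces hw (ext he hd) hφ
  refine Primrec.of_eq (
    cons nil (one (primrec_ind (Primrec.const 0) (Primrec.nat_double.comp hx))) <|
    cons (one hind) (one (primrec_ind wφ hd)) <|
    cons (one (primrec_forces hw he' hψ)) (one (primrec_forces wφ he' hψ)) <|
    cons (one (primrec_holds hw hx hl)) (one (primrec_holds wφ hx hl)) <|
    cons (one (primrec_forces hw he (Primrec.const .bot))) nil <|
    cons (one hat) (one hmap) <|
    cons (one hmap) (one hat) <|
    cons (one fand) (one fφ) <|
    cons (one fand) (one fψ) <|
    cons (two fφ fψ) (one fand) <|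
    cons (one for') (two fφ fψ) <|
    cons (one fφ) (one for') <|
    cons (one fψ) (one for') <|
    cons (two fimp fφ) (one fψ) <|
    cons nil (two fimp (primrec_forces wimp he hφ)) <|
    cons (one (primrec_forces wimp he hψ)) (one fimp) <|
    cons (two fall hind) (one fd) <|
    cons nil (two fall (primrec_ind wall iall)) <|
    cons (one (primrec_forces wall (ext he iall) hφ)) (one fall) <|
    cons (two fd hind) (one fex) <|
    cons (one fex) (one (primrec_ind hw iex)) <|
    cons (one fex) (one (primrec_forces hw (ext he iex) hφ)) <| Primrec.const []) ?_
  rintro ⟨w, e, e', φ, ψ, x, d, l⟩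
  rfl

theorem primrec_pow : Primrec₂ ((· ^ ·) : ℕ → ℕ → ℕ) :=
  Primrec₂.unpaired'.1 Nat.Primrec.pow

theorem primrec_testBit : Primrec₂ Nat.testBit := by
  have h : PrimrecRel fun m i : ℕ => m / 2 ^ i % 2 = 1 :=
    Primrec.eq.comp (Primrec.nat_mod.comp (Primrec.nat_div.comp Primrec.fst
      (primrec_pow.comp (Primrec.const 2) Primrec.snd)) (Primrec.const 2)) (Primrec.const 1)
  exact h.decide.of_eq fun m i => Nat.testBit_eq_decide_div_mod_eq.symm

theorem primrecRel_bitIs (b : Bool) :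
    PrimrecRel fun (β : Bit) (c : ℕ × ℕ) => BitIs c.1 c.2 b β :=
  have hβ : Primrec fun p : Bit × ℕ × ℕ => Encodable.encode p.1 := Primrec.encode.comp Primrec.fst
  (Primrec.nat_lt.comp hβ (Primrec.fst.comp Primrec.snd)).and
    (Primrec.eq.comp (primrec_testBit.comp (Primrec.snd.comp Primrec.snd) hβ) (Primrec.const b))

theorem primrecRel_refutes :
    PrimrecRel fun (s : List Bit × List Bit) (c : ℕ × ℕ) => Refutes c.1 c.2 s :=
  ((primrecRel_bitIs true).forall_mem_list.comp (Primrec.fst.comp Primrec.fst) Primrec.snd).and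
    ((primrecRel_bitIs false).forall_mem_list.comp (Primrec.snd.comp Primrec.fst) Primrec.snd)

theorem primrecRel_certificate : PrimrecRel Certificate := by
  have h₁ : PrimrecRel fun (n : ℕ) (c : ℕ × ℕ) =>
      ∃ s ∈ sequents (Denumerable.ofNat Param n), Refutes c.1 c.2 s :=
    primrecRel_refutes.exists_mem_list.comp
      ((primrec_sequents.comp (Primrec.ofNat Param)).comp Primrec.fst) Primrec.snd
  have h₂ : PrimrecRel fun (m : ℕ) (c : Formula × ℕ) =>
      BitIs c.2 m true (forces 0 [] c.1) ∨
        ∃ n ∈ List.range c.2, ∃ s ∈ sequents (Denumerable.ofNat Param n), Refutes c.2 m s := by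
    have hc : Primrec fun p : ℕ × Formula × ℕ => (p.2.2, p.1) :=
      (Primrec.snd.comp Primrec.snd).pair Primrec.fst
    exact ((primrecRel_bitIs true).comp (primrec_forces (Primrec.const 0) (Primrec.const [])
      (Primrec.fst.comp Primrec.snd)) hc).or
        (h₁.exists_mem_list.comp (Primrec.list_range.comp (Primrec.snd.comp Primrec.snd)) hc)
  refine (h₂.forall_mem_list.comp (Primrec.list_range.comp
    (primrec_pow.comp (Primrec.const 2) Primrec.snd)) Primrec.id).of_eq fun p => ?_
  simp only [List.mem_range, Certificate, id]

theorem primrec_allBelow : Primrec₂ allBelow := by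
  refine (Primrec.nat_rec Primrec.id (g := fun _ p => Formula.all p.1 p.2)
    (primrec_all (Primrec.fst.comp Primrec.snd) (Primrec.snd.comp Primrec.snd)).to₂).swap.of_eq
      fun n φ => ?_
  induction n with
  | zero => rfl
  | succ n ih => exact congrArg (Formula.all n) ih

end Primrec

/-! ### Recursive enumerability of the logics -/

/-- The logic axiomatized by the range of a primitive recursive function is recursively enumerable:
one searches for a list of axioms, a number of variables to generalize over, and a certificate
of the resulting implication. -/
theorem rePred_ext {α : Type*} [Denumerable α] {ax : α → Formula} (hax : Primrec ax)
    {r : Formula → Prop} (hr : PrimrecPred r) :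
    REPred fun φ => Ext (Set.range ax) φ ∧ r φ := by
  have hchain : Primrec fun p : (ℕ × List α × ℕ) × Formula =>
      chain p.1.1 (p.1.2.1.map ax) p.2 := by
    refine (Primrec.list_foldr (f := fun p : (ℕ × List α × ℕ) × Formula => p.1.2.1) (g := Prod.snd)
      (h := fun p q => (allBelow p.1.1 (ax q.1)).imp q.2)
      (Primrec.fst.comp (Primrec.snd.comp Primrec.fst)) Primrec.snd
      (primrec_imp (primrec_allBelow.comp (Primrec.fst.comp (Primrec.fst.comp Primrec.fst))
        (hax.comp (Primrec.fst.comp Primrec.snd))) (Primrec.snd.comp Primrec.snd)).to₂).of_eq ?_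
    exact fun p => by simp only [chain, List.foldr_map]
  have hp : PrimrecRel fun (φ : Formula) (k : ℕ) =>
      let t := Denumerable.ofNat (ℕ × List α × ℕ) k
      Certificate (chain t.1 (t.2.1.map ax) φ) t.2.2 ∧ r φ := by
    have ht : Primrec fun p : Formula × ℕ => Denumerable.ofNat (ℕ × List α × ℕ) p.2 :=
      (Primrec.ofNat _).comp Primrec.snd
    exact (primrecRel_certificate.comp (hchain.comp (ht.pair Primrec.fst))
      (Primrec.snd.comp (Primrec.snd.comp ht))).and (hr.comp Primrec.fst)
  refine (rePred_exists hp).of_eq fun φ => ?_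
  rw [ext_iff_exists_chain]
  constructor
  · rintro ⟨k, hk, hr⟩
    refine ⟨⟨_, _, fun A hA => ?_, mem_QInt_iff_exists_certificate.2 ⟨_, hk⟩⟩, hr⟩
    obtain ⟨a, -, rfl⟩ := List.mem_map.1 hA
    exact ⟨a, rfl⟩
  · rintro ⟨⟨n, L, hL, h⟩, hr⟩
    obtain ⟨L, rfl⟩ : L ∈ Set.range (List.map ax) := by rwa [Set.range_list_map]
    obtain ⟨N, hN⟩ := mem_QInt_iff_exists_certificate.1 h
    exact ⟨Encodable.encode (n, L, N), by simpa only [Denumerable.ofNat_encode] using hN, hr⟩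

theorem rePred_QLC {r : Formula → Prop} (hr : PrimrecPred r) :
    REPred fun φ => φ ∈ QLC ∧ r φ := by
  have hax : Primrec fun p : Formula × Formula => (p.1.imp p.2).or (p.2.imp p.1) :=
    primrec_or (primrec_imp Primrec.fst Primrec.snd) (primrec_imp Primrec.snd Primrec.fst)
  have h : Set.range (fun p : Formula × Formula => (p.1.imp p.2).or (p.2.imp p.1)) = LinAxioms := by
    ext χ
    simp [LinAxioms, eq_comm]
  exact (rePred_ext hax hr).of_eq fun φ => by rw [h]; rfl

theorem rePred_QLCcd {r : Formula → Prop} (hr : PrimrecPred r) :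
    REPred fun φ => φ ∈ QLCcd ∧ r φ := by
  let ax : Formula × Formula ⊕ ℕ × Formula × Formula → Formula := Sum.elim
    (fun p => (p.1.imp p.2).or (p.2.imp p.1))
    (fun p => ((p.2.1.or (p.2.2.all p.1)).all p.1).imp ((p.2.1.all p.1).or (p.2.2.all p.1)))
  have hax : Primrec ax := by
    have hlin : Primrec fun p : Formula × Formula => (p.1.imp p.2).or (p.2.imp p.1) :=
      primrec_or (primrec_imp Primrec.fst Primrec.snd) (primrec_imp Primrec.snd Primrec.fst)
    have hφ : Primrec fun p : ℕ × Formula × Formula => p.2.1 := Primrec.fst.comp Primrec.snd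
    have hψ : Primrec fun p : ℕ × Formula × Formula => p.2.2.all p.1 :=
      primrec_all Primrec.fst (Primrec.snd.comp Primrec.snd)
    have hcd := primrec_imp (primrec_all Primrec.fst (primrec_or hφ hψ))
      (primrec_or (primrec_all Primrec.fst hφ) hψ)
    exact (Primrec.sumCasesOn Primrec.id (hlin.comp Primrec.snd).to₂
      (hcd.comp Primrec.snd).to₂).of_eq fun p => by cases p <;> rfl
  have h : Set.range ax = LinAxioms ∪ QuantifiedCdAxioms := by
    ext χ
    simp [ax, LinAxioms, QuantifiedCdAxioms, eq_comm]
  simp only [mem_QLCcd_iff, ← h]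
  exact rePred_ext hax hr

/-! ### Completeness -/

/-- Only recursive enumerability depends on the logic; the reduction works for all sets of formulas
between `QInt` and `QLC.cd`. -/
theorem sigma1Complete_fragments {L : Set Formula} (h₁ : QInt ⊆ L) (h₂ : L ⊆ QLCcd)
    (h : ∀ r : Formula → Prop, PrimrecPred r → REPred fun φ => φ ∈ L ∧ r φ) :
    Sigma1Complete (positiveFragment L) ∧
      Sigma1Complete (restrictedFragment (positiveFragment L)) := by
  refine ⟨⟨h _ primrecPred_positive, fun q hq => manyOneReducible_of_between
    (L := positiveFragment L)
      (fun φ hφ hpos _ => ⟨h₁ hφ, hpos⟩) (fun φ hφ => h₂ hφ.1) hq⟩,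
    ⟨(h _ (primrecPred_positive.and primrecPred_restricted)).of_eq fun φ =>
        (and_assoc (a := φ ∈ L)).symm,
      fun q hq => manyOneReducible_of_between
        (L := restrictedFragment (positiveFragment L)) (fun φ hφ hpos hres => ⟨⟨h₁ hφ, hpos⟩, hres⟩)
        (fun φ hφ => h₂ hφ.1.1) hq⟩⟩

end IntPred

theorem mainTheorem3 :
    (IntPred.Sigma1Complete (IntPred.positiveFragment IntPred.QLC) ∧
      IntPred.Sigma1Complete
        (IntPred.restrictedFragment (IntPred.positiveFragment IntPred.QLC))) ∧
    (IntPred.Sigma1Complete (IntPred.positiveFragment IntPred.QLCcd) ∧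
      IntPred.Sigma1Complete
        (IntPred.restrictedFragment (IntPred.positiveFragment IntPred.QLCcd))) :=
  ⟨IntPred.sigma1Complete_fragments IntPred.QInt_subset_QLC IntPred.QLC_subset_QLCcd
      fun _ => IntPred.rePred_QLC,
    IntPred.sigma1Complete_fragments
      (IntPred.QInt_subset_QLC.trans IntPred.QLC_subset_QLCcd) subset_rfl
      fun _ => IntPred.rePred_QLCcd⟩
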